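/- **Setting.** A star network consists of a controller and $n\ge 1$ clients; in each cycle the controller has an $m$-bit message for every client and every client has an $m$-bit message for the controller ($m\ge 1$). Every pair of distinct nodes (controller–client and client–client) is joined by a reciprocal link with fading coefficient $h$, constant during the cycle. The coefficients of different links are independent and Rayleigh faded ($|h|$ is Rayleigh with $\mathbb E|h|^2=1$). The bandwidth is $W>0$, the nominal signal-to-noise ratio is $\mathrm{SNR}>0$, and the link has capacity $C=W\log_2(1+|h|^2\,\mathrm{SNR})$; a transmission at rate $R$ is decoded over the link if and only if $R\le C$, and a simultaneous transmission by several nodes is decoded if and only if it is decoded over at least one of their links. **Protocol (flexible-schedule XOR-CoW).** The phase lengths are $T_D,T_U,T_X>0$, the downlink and uplink rates are $R_D=\frac{mn}{T_D}$ and $R_U=\frac{(m+1)n}{T_U}$. Downlink phase: the controller broadcasts all downlink messages at rate $R_D$. Uplink phase: each client broadcasts its message at rate $R_U$, and the controller and all other clients listen. A client is *strong* if it decodes the downlink packet and the controller decodes its uplink message in these phases; if there are $\tilde a$ strong clients, the XOR phase has rate $R_X=R_X^{\tilde a}=\frac{m(n-\tilde a)}{T_X}$. XOR phase: the *relays* are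 the strong clients, and those clients that have the downlink packet, failed in the uplink phase and have a link of capacity at least $R_X$ to the controller. In the slot of a client $y$, the XOR of the downlink and uplink messages of $y$ is sent simultaneously by the controller, if it already has the uplink message of $y$, and by all relays that have the uplink message of $y$ (from the uplink phase, or because the relay is $y$ itself). Whoever receives it and knows one of the two messages obtains the other. The cycle *fails* if the downlink or the uplink message of at least one client has not reached its destination at the end. **Notation.** For a rate $R$ let $p(R)=1-\exp\left(-\frac{2^{R/W}-1}{\mathrm{SNR}}\right)$, and write $p_D=p(R_D)$, $p_U=p(R_U)$, $p_X=p(R_X^{\tilde a})$. Let $B(N,k,p)=\binom Nk(1-p)^kp^{N-k}$ and $F(N,p)=1-(1-p)^N$, and $$q_{UD}=\tfrac{p_U}{p_D},\quad s_{UD}=\tfrac{p_U-p_D}{1-p_D},\quad s_{XU}=\tfrac{p_X-p_U}{1-p_U},\quad s_{XD}=\tfrac{p_X-p_D}{1-p_D},\quad r_{UX,UD}=\tfrac{p_X-p_U}{p_D-p_U},\quad r_{DX,DU}=\tfrac{p_X-p_D}{p_U-p_D}.$$ **Theorem.** (i) For every link and every $R\ge0$, $P(R>C)=p(R)$. (ii)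 For every link, and every possible value $0\le\tilde a\le n$ in $R_X=R_X^{\tilde a}$: $q_{UD}=P(C<R_U\mid C<R_D)$ if $R_U\le R_D$; $s_{UD}=P(C<R_U\mid C>R_D)$ if $R_D\le R_U$; $s_{XU}=P(C<R_X\mid C>R_U)$ if $R_U\le R_X$; $s_{XD}=P(C<R_X\mid C>R_D)$ if $R_D\le R_X$; $r_{UX,UD}=P(R_U<C<R_X\mid R_U<C<R_D)$ if $R_U\le R_X\le R_D$ and $R_U<R_D$; $r_{DX,DU}=P(R_D<C<R_X\mid R_D<C<R_U)$ if $R_D\le R_X\le R_U$ and $R_D<R_U$. (iii) The probability that the cycle fails is $$\begin{aligned}P(\text{fail})=\sum_{a=0}^n\Bigg[&\sum_{b=0}^{n-a}P(\text{fail}_1)\mathbf 1(R_D\ge R_U>R_X)+\sum_{b=0}^{n-a}\sum_{\tilde b=0}^{b}P(\text{fail}_2)\mathbf 1(R_D>R_X\ge R_U)\\&+\sum_{\tilde a=0}^{a}P(\text{fail}_3)\mathbf 1(R_U>R_D>R_X)+\sum_{\tilde a=0}^{a}\sum_{\check a_X=0}^{a-\tilde a}P(\text{fail}_4)\mathbf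 1(R_U>R_X\ge R_D)\\&+\sum_{\tilde a=0}^{a}\sum_{\tilde a_X=0}^{\tilde a}P(\text{fail}_5)\mathbf 1(R_X\ge R_U>R_D)+\sum_{\tilde a_X=0}^{a}\sum_{b=0}^{n-a}P(\text{fail}_6)\mathbf 1(R_X\ge R_D\ge R_U)\Bigg],\end{aligned}$$ where $R_X=R_X^{\tilde a}$ and $p_X=p(R_X^{\tilde a})$ are taken at the summation index $\tilde a$ in the terms 3, 4, 5 and at $\tilde a=a$ in the terms 1, 2, 6, where $\check a=a-\tilde a$, and $$P(\text{fail}_1)=B(n,a,p_D)\,B(n-a,b,q_{UD})\,F(n-a-b,p_U^a),$$ $$P(\text{fail}_2)=B(n,a,p_D)\,B(n-a,b,q_{UD})\,B(b,\tilde b,r_{UX,UD})\,F(n-a-\tilde b,p_X^a),$$ $$P(\text{fail}_3)=B(n,a,p_D)\,B(a,\tilde a,s_{UD})\,F(n-a,p_U^a),$$ $$P(\text{fail}_4)=B(n,a,p_D)\,B(a,\tilde a,s_{UD})\,B(\check a,\check a_X,r_{DX,DU})\,F(n-\tilde a-\check a_X,p_U^{\tilde a+\check a_X}),$$ $$P(\text{fail}_5)=B(n,a,p_D)\,B(a,\tilde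 a,s_{UD})\,B(\tilde a,\tilde a_X,s_{XU})\,(1-P(\text{success}_5)),$$ $$P(\text{success}_5)=(1-p_U^{\tilde a_X})^{\check a}\left(\sum_{k=1}^{\tilde a_X}B(\tilde a_X,k,p_U)\left(1-s_{XU}^k+s_{XU}^k(1-p_X^{\tilde a-\tilde a_X})\right)\right)^{n-a},$$ $$P(\text{fail}_6)=B(n,a,p_D)\,B(a,\tilde a_X,s_{XD})\,B(n-a,b,q_{UD})\,(1-P(\text{success}_6)),$$ $$P(\text{success}_6)=(1-p_X^{a})^{b}\left(\sum_{k=1}^{\tilde a_X}B(\tilde a_X,k,p_U)\left(1-s_{XU}^k+s_{XU}^k(1-p_X^{a-\tilde a_X})\right)\right)^{n-a-b},$$ with $0^0=1$. -/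

import Mathlib

open MeasureTheory ProbabilityTheory Finset

noncomputable section

namespace XorCow

/-! ### Links, fading and capacity -/

/-- The nodes of a star network with `n` clients: `none` is the controller,
`some i` is the `i`-th client. -/
abbrev Node (n : ℕ) : Type := Option (Fin n)

/-- The Rayleigh distribution with density `x / v * exp (-x ^ 2 / (2 * v))` on the positive
half-line; its mean square is `2 * v`. -/
def rayleighMeasure (v : ℝ) : Measure ℝ :=
  volume.withDensity fun x =>
    ENNReal.ofReal (if 0 < x then x / v * Real.exp (-x ^ 2 / (2 * v)) else 0)

/-- Parameters: number `n` of clients, message size `m` in bits, bandwidth `W`, nominal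
signal-to-noise ratio `snr`, and the lengths of the downlink, uplink and XOR phases. -/
structure Params where
  n : ℕ
  m : ℕ
  W : ℝ
  snr : ℝ
  TD : ℝ
  TU : ℝ
  TX : ℝ

namespace Params

variable (P : Params)

/-- Capacity of a link with fading coefficient `h`. -/
def capacity (h : ℂ) : ℝ := P.W * Real.logb 2 (1 + ‖h‖ ^ 2 * P.snr)

/-- Downlink rate. -/
def RD : ℝ := (P.m : ℝ) * P.n / P.TD

/-- Uplink rate of the flexible schedule (each client adds a one bit acknowledgement). -/
def RU : ℝ := ((P.m : ℝ) + 1) * P.n / P.TU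

/-- XOR-phase rate of the flexible schedule when there are `s` strong clients. -/
def RX (s : ℕ) : ℝ := (P.m : ℝ) * ((P.n : ℝ) - s) / P.TX

/-- The closed form for the probability that a single link fails at rate `R`. -/
def pfail (R : ℝ) : ℝ := 1 - Real.exp (-(((2 : ℝ) ^ (R / P.W) - 1) / P.snr))

def pD : ℝ := P.pfail P.RD

def pU : ℝ := P.pfail P.RU

def pX (s : ℕ) : ℝ := P.pfail (P.RX s)

end Params

/-! ### The flexible-schedule protocol, for given link capacities

`C s(u, v)` is the capacity of the (reciprocal) link between the nodes `u` and `v`; it is the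
same in all phases of a cycle. A transmission at rate `R` over a link is decoded if and only if
`R ≤ C s(u, v)`; a simultaneous transmission by several nodes is decoded if and only if it is
decoded over at least one of the links. Values of `C` on the diagonal play no role. -/

section Protocol

variable (P : Params) (C : Sym2 (Node P.n) → ℝ)

/-- Client `i` decodes the controller's downlink packet in the downlink phase. -/
def DownDirect (i : Fin P.n) : Prop := P.RD ≤ C s(none, some i)

/-- After the uplink phase, node `v` has the uplink message of client `y`. -/
def HasUplink (v : Node P.n) (y : Fin P.n) : Prop := v = some y ∨ P.RU ≤ C s(v, some y)

open Classical in
/-- The strong clients: successful both in the downlink phase and in the uplink phase. -/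
def strong : Finset (Fin P.n) :=
  univ.filter fun i => DownDirect P C i ∧ HasUplink P C none i

/-- The rate of the XOR phase: its time is divided among the clients that are not strong. -/
def xorRate : ℝ := P.RX (strong P C).card

/-- The clients acting as relays in the XOR phase: the strong clients, and the clients that have
the downlink packet, failed in the uplink phase, and can reach the controller in the XOR phase. -/
def IsRelay (i : Fin P.n) : Prop :=
  i ∈ strong P C ∨
    (DownDirect P C i ∧ ¬ HasUplink P C none i ∧ xorRate P C ≤ C s(none, some i))

/-- In the XOR-phase slot of client `y`, the XOR of the downlink and uplink messages of `y` is sent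
by the controller, if it has the uplink message, and by all relays that have it. -/
def XorSender (y : Fin P.n) : Node P.n → Prop
  | none => HasUplink P C none y
  | some i => IsRelay P C i ∧ HasUplink P C (some i) y

/-- The uplink message of `y` reaches the controller within the cycle. -/
def UplinkDelivered (y : Fin P.n) : Prop :=
  HasUplink P C none y ∨
    ∃ z : Fin P.n, XorSender P C y (some z) ∧ xorRate P C ≤ C s(some z, none)

/-- The downlink message of `y` reaches `y` within the cycle. -/
def DownlinkDelivered (y : Fin P.n) : Prop :=
  DownDirect P C y ∨
    ∃ v : Node P.n, v ≠ some y ∧ XorSender P C y v ∧ xorRate P C ≤ C s(v, some y)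

/-- The cycle fails: some message does not reach its destination. -/
def CycleFails : Prop :=
  ∃ y : Fin P.n, ¬ (UplinkDelivered P C y ∧ DownlinkDelivered P C y)

end Protocol

/-! ### The closed form -/

/-- Probability of `k` successes in `n` independent experiments with failure probability `p`. -/
def B (n k : ℕ) (p : ℝ) : ℝ := (n.choose k : ℝ) * (1 - p) ^ k * p ^ (n - k)

/-- Probability that at least one of `n` independent experiments fails. -/
def F (n : ℕ) (p : ℝ) : ℝ := 1 - (1 - p) ^ n

namespace Params

variable (P : Params)

def qUD : ℝ := P.pU / P.pD

def sUD : ℝ := (P.pU - P.pD) / (1 - P.pD)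

def sXU (s : ℕ) : ℝ := (P.pX s - P.pU) / (1 - P.pU)

def sXD (s : ℕ) : ℝ := (P.pX s - P.pD) / (1 - P.pD)

/-- `r_{UX,UD}` -/
def rUXUD (s : ℕ) : ℝ := (P.pX s - P.pU) / (P.pD - P.pU)

/-- `r_{DX,DU}` -/
def rDXDU (s : ℕ) : ℝ := (P.pX s - P.pD) / (P.pU - P.pD)

/-- Case `R_D ≥ R_U > R_X` (here there are `a` strong clients). -/
def fail1 (a b : ℕ) : ℝ :=
  B P.n a P.pD * B (P.n - a) b P.qUD * F (P.n - a - b) (P.pU ^ a)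

/-- Case `R_D > R_X ≥ R_U` (here there are `a` strong clients). -/
def fail2 (a b b' : ℕ) : ℝ :=
  B P.n a P.pD * B (P.n - a) b P.qUD * B b b' (P.rUXUD a) * F (P.n - a - b') (P.pX a ^ a)

/-- Case `R_U > R_D > R_X`, with `s` strong clients. -/
def fail3 (a s : ℕ) : ℝ :=
  B P.n a P.pD * B a s P.sUD * F (P.n - a) (P.pU ^ a)

/-- Case `R_U > R_X ≥ R_D`, with `s` strong clients. -/
def fail4 (a s x : ℕ) : ℝ :=
  B P.n a P.pD * B a s P.sUD * B (a - s) x (P.rDXDU s) * F (P.n - s - x) (P.pU ^ (s + x))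

/-- Success probability, in the cases where `R_X` is the largest rate, of a client that succeeded
neither in the downlink nor in the uplink phase; there are `s` strong clients, `x` of which keep
their link to the controller in the XOR phase. -/
def relaySuccess (s x : ℕ) : ℝ :=
  ∑ k ∈ Icc 1 x,
    B x k P.pU * (1 - P.sXU s ^ k + P.sXU s ^ k * (1 - P.pX s ^ (s - x)))

def success5 (a s x : ℕ) : ℝ :=
  (1 - P.pU ^ x) ^ (a - s) * P.relaySuccess s x ^ (P.n - a)

/-- Case `R_X ≥ R_U > R_D`, with `s` strong clients. -/
def fail5 (a s x : ℕ) : ℝ :=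
  B P.n a P.pD * B a s P.sUD * B s x (P.sXU s) * (1 - P.success5 a s x)

def success6 (a x b : ℕ) : ℝ :=
  (1 - P.pX a ^ a) ^ b * P.relaySuccess a x ^ (P.n - a - b)

/-- Case `R_X ≥ R_D ≥ R_U` (here there are `a` strong clients). -/
def fail6 (a x b : ℕ) : ℝ :=
  B P.n a P.pD * B a x (P.sXD a) * B (P.n - a) b P.qUD * (1 - P.success6 a x b)

/-- The closed form for the cycle-failure probability. -/
def failFormula : ℝ :=
  ∑ a ∈ Icc 0 P.n,
    ((∑ b ∈ Icc 0 (P.n - a),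
        if P.RD ≥ P.RU ∧ P.RU > P.RX a then P.fail1 a b else 0) +
     (∑ b ∈ Icc 0 (P.n - a), ∑ b' ∈ Icc 0 b,
        if P.RD > P.RX a ∧ P.RX a ≥ P.RU then P.fail2 a b b' else 0) +
     (∑ s ∈ Icc 0 a,
        if P.RU > P.RD ∧ P.RD > P.RX s then P.fail3 a s else 0) +
     (∑ s ∈ Icc 0 a, ∑ x ∈ Icc 0 (a - s),
        if P.RU > P.RX s ∧ P.RX s ≥ P.RD then P.fail4 a s x else 0) +
     (∑ s ∈ Icc 0 a, ∑ x ∈ Icc 0 s,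
        if P.RX s ≥ P.RU ∧ P.RU > P.RD then P.fail5 a s x else 0) +
     (∑ x ∈ Icc 0 a, ∑ b ∈ Icc 0 (P.n - a),
        if P.RX a ≥ P.RD ∧ P.RD ≥ P.RU then P.fail6 a x b else 0))

end Params

end XorCow

end

noncomputable section

namespace XorCow

/-! ### The law of a single link -/

/-! A squared Rayleigh amplitude of mean one is exponential, so a link capacity falls below `R ≥ 0`
with probability `P.pfail R` and has no atom there. This gives the single-link claims; all that is
used afterwards is packaged as `LinkLaw` and `IndepLinks`.

For the cycle, the links from the controller are fixed first. The ranges of their capacities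
relative to the three rates determine the strong clients, hence the XOR rate, and then who relays
(`K`), which relays reach the controller (`L`), and which clients depend on relays for the uplink
(`NU`) or the downlink (`ND`). By `not_cycleFails_iff` the cycle succeeds exactly when every client
of `NU ∪ ND` has suitable links to `K` and `L`. No such client is a relay, so different clients use
disjoint sets of links, and these are also disjoint from the controller links. Therefore
`measureReal_relays` gives a product: one factor per controller link and one factor per dependent
client. The factor of a client needing both messages comes from inclusion–exclusion,
`IndepLinks.measureReal_exists_ge_and`.

The result depends only on cardinalities, so summing over configurations produces binomial
coefficients (`measureReal_eq_sum_powerset`, `sum_powerset_of_choose_mul`). Matching with the closed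
form takes two identities: `pow_mul_B` turns conditional link probabilities into probabilities of
ranges, and `sum_B_mul_relay` collapses the sum in `relaySuccess` to the inclusion–exclusion
expression. The six terms are the six orderings of the rates. -/

lemma rayleighMeasure_half_Iio {x : ℝ} (hx : 0 ≤ x) :
    rayleighMeasure (1 / 2) (Set.Iio x) = ENNReal.ofReal (1 - Real.exp (-x ^ 2)) := by
  have hd : ∀ y : ℝ, HasDerivAt (fun y => -Real.exp (-y ^ 2)) (y / (1 / 2) * Real.exp (-y ^ 2)) y := by
    intro y
    have h1 : HasDerivAt (fun y : ℝ => -y ^ 2) (-(2 * y)) y := by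
      simpa using (hasDerivAt_pow 2 y).fun_neg
    exact h1.exp.fun_neg.congr_deriv (by ring)
  have hc : Continuous fun y : ℝ => y / (1 / 2) * Real.exp (-y ^ 2) := by fun_prop
  have hint : ∫ y in (0 : ℝ)..x, y / (1 / 2) * Real.exp (-y ^ 2) = 1 - Real.exp (-x ^ 2) := by
    rw [intervalIntegral.integral_eq_sub_of_hasDerivAt (fun y _ => hd y) (hc.intervalIntegrable _ _)]
    simp
    ring
  rw [rayleighMeasure, withDensity_apply _ measurableSet_Iio, ← hint,
    intervalIntegral.integral_of_le hx, integral_Ioc_eq_integral_Ioo,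
    ofReal_integral_eq_lintegral_ofReal]
  -- The density vanishes on the nonpositive half-line, so only `(0, x)` contributes.
  · have hsplit : (Set.Iio x : Set ℝ) = Set.Iic 0 ∩ Set.Iio x ∪ Set.Ioo 0 x := by
      ext y
      simp only [Set.mem_Iio, Set.mem_union, Set.mem_inter_iff, Set.mem_Iic, Set.mem_Ioo]
      constructor
      · intro h
        rcases le_or_gt y 0 with h0 | h0
        · exact Or.inl ⟨h0, h⟩
        · exact Or.inr ⟨h0, h⟩
      · rintro (h | h) <;> exact h.2
    have hdisj : Disjoint (Set.Iic 0 ∩ Set.Iio x : Set ℝ) (Set.Ioo 0 x) := by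
      rw [Set.disjoint_left]
      rintro y ⟨h1, -⟩ ⟨h2, -⟩
      exact absurd h2 (not_lt.mpr h1)
    rw [hsplit, lintegral_union measurableSet_Ioo hdisj]
    rw [setLIntegral_congr_fun (g := fun _ => 0) (measurableSet_Iic.inter measurableSet_Iio)]
    · rw [setLIntegral_congr_fun measurableSet_Ioo
        (g := fun y => ENNReal.ofReal (y / (1 / 2) * Real.exp (-y ^ 2)))]
      · simp
      · intro y hy
        simp [hy.1]
    · intro y hy
      have : ¬ 0 < y := not_lt.mpr hy.1
      simp [this]
  · exact (hc.integrableOn_Icc).mono_set Set.Ioo_subset_Icc_self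
  · refine (ae_restrict_iff' measurableSet_Ioo).mpr (Filter.Eventually.of_forall fun y hy => ?_)
    have := hy.1
    simp only [Pi.zero_apply]
    positivity

lemma rayleighMeasure_singleton (v x : ℝ) : rayleighMeasure v {x} = 0 :=
  withDensity_absolutelyContinuous _ _ (by simp)

namespace Params

variable {P : Params}

/-- The fading amplitude at which the capacity of a link equals the rate `R`. -/
def threshold (P : Params) (R : ℝ) : ℝ := √(((2 : ℝ) ^ (R / P.W) - 1) / P.snr)

lemma threshold_nonneg (R : ℝ) : 0 ≤ P.threshold R := Real.sqrt_nonneg _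

lemma threshold_arg_nonneg (hW : 0 < P.W) (hsnr : 0 < P.snr) {R : ℝ} (hR : 0 ≤ R) :
    0 ≤ ((2 : ℝ) ^ (R / P.W) - 1) / P.snr := by
  have : (1 : ℝ) ≤ 2 ^ (R / P.W) := Real.one_le_rpow (by norm_num) (by positivity)
  exact div_nonneg (by linarith) hsnr.le

/-- No sign condition on `R` is needed: for `R < 0` the real square root in `threshold` is `0`, and
both sides are false. The non-strict version does need `0 ≤ R`. -/
lemma capacity_lt_iff (hW : 0 < P.W) (hsnr : 0 < P.snr) (R : ℝ) (z : ℂ) :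
    P.capacity z < R ↔ ‖z‖ < P.threshold R := by
  have h1 : 0 < 1 + ‖z‖ ^ 2 * P.snr := by positivity
  rw [capacity, mul_comm, ← lt_div_iff₀ hW, Real.logb_lt_iff_lt_rpow (by norm_num) h1, threshold,
    Real.lt_sqrt (norm_nonneg z), lt_div_iff₀ hsnr]
  constructor <;> intro h <;> linarith

lemma capacity_le_iff (hW : 0 < P.W) (hsnr : 0 < P.snr) {R : ℝ} (hR : 0 ≤ R) (z : ℂ) :
    P.capacity z ≤ R ↔ ‖z‖ ≤ P.threshold R := by
  have h0 := threshold_arg_nonneg hW hsnr hR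
  have h1 : 0 < 1 + ‖z‖ ^ 2 * P.snr := by positivity
  rw [capacity, mul_comm, ← le_div_iff₀ hW, Real.logb_le_iff_le_rpow (by norm_num) h1, threshold,
    Real.le_sqrt (norm_nonneg z) h0, le_div_iff₀ hsnr]
  constructor <;> intro h <;> linarith

lemma measurable_capacity : Measurable P.capacity := by
  unfold capacity Real.logb
  fun_prop

lemma pfail_eq (hW : 0 < P.W) (hsnr : 0 < P.snr) {R : ℝ} (hR : 0 ≤ R) :
    P.pfail R = 1 - Real.exp (-P.threshold R ^ 2) := by
  rw [pfail, threshold, Real.sq_sqrt (threshold_arg_nonneg hW hsnr hR)]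

lemma pfail_lt_one (R : ℝ) : P.pfail R < 1 := by
  have := Real.exp_pos (-(((2 : ℝ) ^ (R / P.W) - 1) / P.snr))
  unfold pfail
  linarith

lemma pfail_strictMono (hW : 0 < P.W) (hsnr : 0 < P.snr) : StrictMono P.pfail := by
  intro a b hab
  have h1 : (2 : ℝ) ^ (a / P.W) < 2 ^ (b / P.W) :=
    Real.rpow_lt_rpow_of_exponent_lt (by norm_num) (by gcongr)
  unfold pfail
  gcongr

lemma pfail_zero : P.pfail 0 = 0 := by simp [pfail]

lemma pfail_pos (hW : 0 < P.W) (hsnr : 0 < P.snr) {R : ℝ} (hR : 0 < R) : 0 < P.pfail R :=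
  (P.pfail_zero).symm.trans_lt (pfail_strictMono hW hsnr hR)

end Params

section SingleLink

variable {Ω : Type*} [MeasurableSpace Ω] {μ : Measure Ω} {P : Params}
  {g : Ω → ℂ}

lemma measureReal_capacity_lt (hW : 0 < P.W) (hsnr : 0 < P.snr)
    (hlaw : HasLaw (fun ω => ‖g ω‖) (rayleighMeasure (1 / 2)) μ) {R : ℝ} (hR : 0 ≤ R) :
    μ.real {ω | P.capacity (g ω) < R} = P.pfail R := by
  have h1 : {ω | P.capacity (g ω) < R} = (fun ω => ‖g ω‖) ⁻¹' Set.Iio (P.threshold R) := by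
    ext ω
    simp [Params.capacity_lt_iff hW hsnr R]
  rw [h1, measureReal_def, ← Measure.map_apply_of_aemeasurable hlaw.aemeasurable measurableSet_Iio,
    hlaw.map_eq, rayleighMeasure_half_Iio (Params.threshold_nonneg R), ENNReal.toReal_ofReal,
    Params.pfail_eq hW hsnr hR]
  rw [sub_nonneg, Real.exp_le_one_iff]
  simp [sq_nonneg]

/-- Absence of atoms reconciles the strict inequalities in the conditional probabilities with the
decoding rule `R ≤ C`. -/
lemma measure_capacity_eq (hW : 0 < P.W) (hsnr : 0 < P.snr)
    (hlaw : HasLaw (fun ω => ‖g ω‖) (rayleighMeasure (1 / 2)) μ) {R : ℝ} (hR : 0 ≤ R) :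
    μ {ω | P.capacity (g ω) = R} = 0 := by
  have h1 : {ω | P.capacity (g ω) = R} ⊆ (fun ω => ‖g ω‖) ⁻¹' {P.threshold R} := by
    intro ω hω
    have hω : P.capacity (g ω) = R := hω
    have h2 : ‖g ω‖ ≤ P.threshold R := (Params.capacity_le_iff hW hsnr hR _).mp hω.le
    have h3 : ¬ ‖g ω‖ < P.threshold R := fun h =>
      absurd ((Params.capacity_lt_iff hW hsnr R _).mpr h) (not_lt.mpr hω.ge)
    exact le_antisymm h2 (not_lt.mp h3)
  refine measure_mono_null h1 ?_
  rw [← Measure.map_apply_of_aemeasurable hlaw.aemeasurable (measurableSet_singleton _),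
    hlaw.map_eq, rayleighMeasure_singleton]

end SingleLink

/-! ### Interval and conditional probabilities of one link. -/

/-- A random capacity with continuous distribution function `p` on the nonnegative reals. -/
structure LinkLaw {Ω : Type*} [MeasurableSpace Ω] (μ : Measure Ω) (p : ℝ → ℝ) (c : Ω → ℝ) :
    Prop where
  measurable : Measurable c
  lt : ∀ R, 0 ≤ R → μ.real {ω | c ω < R} = p R
  eq : ∀ R, 0 ≤ R → μ {ω | c ω = R} = 0

namespace LinkLaw

variable {Ω : Type*} [MeasurableSpace Ω] {μ : Measure Ω} {p : ℝ → ℝ} {c : Ω → ℝ} {x y z : ℝ}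

lemma ge [IsProbabilityMeasure μ] (H : LinkLaw μ p c) (hx : 0 ≤ x) : μ.real {ω | x ≤ c ω} = 1 - p x := by
  have h1 : {ω | x ≤ c ω} = {ω | c ω < x}ᶜ := by ext; simp
  rw [h1, probReal_compl_eq_one_sub (measurableSet_lt H.measurable measurable_const), H.lt x hx]

lemma ico [IsProbabilityMeasure μ] (H : LinkLaw μ p c) (hx : 0 ≤ x) (hxy : x ≤ y) : μ.real {ω | x ≤ c ω ∧ c ω < y} = p y - p x := by
  have h1 : {ω | x ≤ c ω ∧ c ω < y} = {ω | c ω < y} \ {ω | c ω < x} := by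
    ext; simp [and_comm]
  have h2 : {ω | c ω < x} ⊆ {ω | c ω < y} := fun ω (h : c ω < x) => h.trans_le hxy
  rw [h1, measureReal_sdiff h2 (measurableSet_lt H.measurable measurable_const), H.lt x hx, H.lt y (hx.trans hxy)]

lemma ae_ne (H : LinkLaw μ p c) (hx : 0 ≤ x) : ∀ᵐ ω ∂μ, c ω ≠ x := by
  rw [ae_iff]
  simpa using H.eq x hx

lemma gt [IsProbabilityMeasure μ] (H : LinkLaw μ p c) (hx : 0 ≤ x) : μ.real {ω | c ω > x} = 1 - p x := by
  rw [← H.ge hx]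
  refine measureReal_congr ?_
  filter_upwards [H.ae_ne hx] with ω hω
  exact propext ⟨fun h => le_of_lt h, fun h => lt_of_le_of_ne h (Ne.symm hω)⟩

lemma ioo [IsProbabilityMeasure μ] (H : LinkLaw μ p c) (hx : 0 ≤ x) (hxy : x ≤ y) : μ.real {ω | x < c ω ∧ c ω < y} = p y - p x := by
  rw [← H.ico hx hxy]
  refine measureReal_congr ?_
  filter_upwards [H.ae_ne hx] with ω hω
  exact propext ⟨fun h => ⟨h.1.le, h.2⟩, fun h => ⟨lt_of_le_of_ne h.1 (Ne.symm hω), h.2⟩⟩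

/-- Conditioning on a null event causes no exception: the conditional measure is then zero, as is
real division by zero. The same holds in the two lemmas on conditioning below. -/
lemma cond_lt_lt (H : LinkLaw μ p c) (hx : 0 ≤ x) (hxy : x ≤ y) :
    (μ[|{ω | c ω < y}]).real {ω | c ω < x} = p x / p y := by
  have h1 : {ω | c ω < y} ∩ {ω | c ω < x} = {ω | c ω < x} := by
    ext ω
    simp only [Set.mem_inter_iff, Set.mem_ofPred_eq, and_iff_right_iff_imp]
    exact fun h => h.trans_le hxy
  rw [measureReal_def, cond_apply (measurableSet_lt H.measurable measurable_const), h1,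
    ENNReal.toReal_mul, ENNReal.toReal_inv, ← measureReal_def, ← measureReal_def, H.lt x hx,
    H.lt y (hx.trans hxy)]
  ring

lemma cond_gt_lt [IsProbabilityMeasure μ] (H : LinkLaw μ p c) (hx : 0 ≤ x) (hxy : x ≤ y) :
    (μ[|{ω | c ω > x}]).real {ω | c ω < y} = (p y - p x) / (1 - p x) := by
  have h1 : {ω | c ω > x} ∩ {ω | c ω < y} = {ω | x < c ω ∧ c ω < y} := rfl
  rw [measureReal_def, cond_apply (measurableSet_lt measurable_const H.measurable), h1,
    ENNReal.toReal_mul, ENNReal.toReal_inv, ← measureReal_def, ← measureReal_def, H.gt hx,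
    H.ioo hx hxy]
  ring

lemma cond_ioo_ioo [IsProbabilityMeasure μ] (H : LinkLaw μ p c) (hx : 0 ≤ x) (hxy : x ≤ y) (hyz : y ≤ z) :
    (μ[|{ω | x < c ω ∧ c ω < z}]).real {ω | x < c ω ∧ c ω < y} = (p y - p x) / (p z - p x) := by
  have h1 : {ω | x < c ω ∧ c ω < z} ∩ {ω | x < c ω ∧ c ω < y} = {ω | x < c ω ∧ c ω < y} := by
    ext ω
    simp only [Set.mem_inter_iff, Set.mem_ofPred_eq, and_iff_right_iff_imp]
    exact fun h => ⟨h.1, h.2.trans_le hyz⟩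
  have h2 : MeasurableSet {ω | x < c ω ∧ c ω < z} :=
    (measurableSet_lt measurable_const H.measurable).inter
      (measurableSet_lt H.measurable measurable_const)
  rw [measureReal_def, cond_apply h2, h1,
    ENNReal.toReal_mul, ENNReal.toReal_inv, ← measureReal_def, ← measureReal_def,
    H.ioo hx (hxy.trans hyz), H.ioo hx hxy]
  ring

end LinkLaw

/-! ### Families of independent links -/

section Links

variable {Ω V : Type*}

/-- The links between distinct nodes are independent, and each of them has the continuous
distribution function `p` on the nonnegative reals. -/
structure IndepLinks [MeasurableSpace Ω] (μ : Measure Ω) (p : ℝ → ℝ) (c : Sym2 V → Ω → ℝ) : Prop where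
  indep : iIndepFun (fun e : {e : Sym2 V // ¬ e.IsDiag} => c e.1) μ
  law : ∀ e, ¬ e.IsDiag → LinkLaw μ p (c e)

/-- The `σ`-algebra generated by the capacities of the links in `S`. -/
@[reducible]
def linkSigma (c : Sym2 V → Ω → ℝ) (S : Set (Sym2 V)) : MeasurableSpace Ω :=
  ⨆ e ∈ {e : {e : Sym2 V // ¬ e.IsDiag} | e.1 ∈ S}, MeasurableSpace.comap (c e.1) inferInstance

lemma linkSigma_mono (c : Sym2 V → Ω → ℝ) {S T : Set (Sym2 V)} (h : S ⊆ T) :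
    linkSigma c S ≤ linkSigma c T :=
  biSup_mono fun _ he => h he

lemma measurableSet_linkSigma_preimage (c : Sym2 V → Ω → ℝ) {S : Set (Sym2 V)} {e : Sym2 V}
    (he : e ∈ S) (hd : ¬ e.IsDiag) {I : Set ℝ} (hI : MeasurableSet I) :
    MeasurableSet[linkSigma c S] (c e ⁻¹' I) := by
  have h1 : MeasurableSpace.comap (c e) inferInstance ≤ linkSigma c S :=
    le_biSup (fun e : {e : Sym2 V // ¬ e.IsDiag} => MeasurableSpace.comap (c e.1) inferInstance)
      (i := ⟨e, hd⟩) he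
  exact h1 _ ⟨I, hI, rfl⟩

/-- The links to a node `y` from the nodes in `N`. -/
def linksTo (N : Finset V) (y : V) : Set (Sym2 V) := {e | ∃ z ∈ N, e = s(z, y)}

/-- The condition `y ∉ N` keeps diagonal pairs out, since `linkSigma` only contains links between
distinct nodes. -/
lemma measurableSet_exists_ge (c : Sym2 V → Ω → ℝ) {N M : Finset V} (hMN : M ⊆ N) {y : V}
    (hy : y ∉ N) (t : ℝ) :
    MeasurableSet[linkSigma c (linksTo N y)] {ω | ∃ z ∈ M, t ≤ c s(z, y) ω} := by
  have h1 : {ω | ∃ z ∈ M, t ≤ c s(z, y) ω} = ⋃ z ∈ M, c s(z, y) ⁻¹' Set.Ici t := by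
    ext ω
    simp
  rw [h1]
  refine Finset.measurableSet_biUnion M fun z hz => ?_
  have hmem : s(z, y) ∈ linksTo N y := ⟨z, hMN hz, rfl⟩
  refine measurableSet_linkSigma_preimage c hmem ?_ measurableSet_Ici
  intro h
  exact hy ((Sym2.mk_isDiag_iff.mp h) ▸ hMN hz)

variable [mΩ : MeasurableSpace Ω] {μ : Measure Ω} {p : ℝ → ℝ} {c : Sym2 V → Ω → ℝ}

lemma IndepLinks.linkSigma_le (H : IndepLinks μ p c) (S : Set (Sym2 V)) :
    linkSigma c S ≤ mΩ :=
  iSup₂_le fun e _ => (H.law e.1 e.2).measurable.comap_le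

variable [IsProbabilityMeasure μ]

/-- Events that depend on pairwise disjoint sets of links are independent. -/
lemma IndepLinks.measureReal_iInter (H : IndepLinks μ p c) {ι : Type*} (J : Finset ι)
    (S : ι → Set (Sym2 V)) (hS : (J : Set ι).PairwiseDisjoint S) (E : ι → Set Ω)
    (hE : ∀ j ∈ J, MeasurableSet[linkSigma c (S j)] (E j)) :
    μ.real (⋂ j ∈ J, E j) = ∏ j ∈ J, μ.real (E j) := by
  classical
  induction J using Finset.induction_on with
  | empty => simp
  | insert a J ha ih =>
    rw [Finset.set_biInter_insert, Finset.prod_insert ha, ← ih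
      (hS.subset (by simp)) (fun j hj => hE j (mem_insert_of_mem hj))]
    have hdisj : Disjoint (S a) (⋃ j ∈ J, S j) := by
      rw [Set.disjoint_iUnion₂_right]
      intro j hj
      exact hS (by simp) (by simp [hj]) (fun h => ha (h ▸ hj))
    -- Grouping: σ-algebras generated by disjoint subfamilies of an independent family are
    -- independent.
    have hind := indep_iSup_of_disjoint (μ := μ)
      (m := fun e : {e : Sym2 V // ¬ e.IsDiag} => MeasurableSpace.comap (c e.1) inferInstance)
      (fun e => (H.law e.1 e.2).measurable.comap_le) H.indep.iIndep
      (S := {e | e.1 ∈ S a}) (T := {e | e.1 ∈ ⋃ j ∈ J, S j})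
      (by
        rw [Set.disjoint_left] at hdisj ⊢
        exact fun e h1 h2 => hdisj h1 h2)
    have h2 : MeasurableSet[linkSigma c (⋃ j ∈ J, S j)] (⋂ j ∈ J, E j) := by
      refine Finset.measurableSet_biInter J fun j hj => ?_
      exact linkSigma_mono c (Set.subset_biUnion_of_mem (u := S) (mem_coe.mpr hj)) _
        (hE j (mem_insert_of_mem hj))
    have h3 := (Indep_iff _ _ μ).mp hind _ _ (hE a (mem_insert_self a J)) h2
    rw [measureReal_def, h3, ENNReal.toReal_mul, ← measureReal_def, ← measureReal_def]

/-- Prescribed ranges for the links from `y` to the nodes in `N`. -/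
lemma IndepLinks.measureReal_forall_lt (H : IndepLinks μ p c) (N : Finset V) (y : V)
    (hy : y ∉ N) (τ : V → ℝ) (hτ : ∀ z ∈ N, 0 ≤ τ z) :
    μ.real {ω | ∀ z ∈ N, c s(z, y) ω < τ z} = ∏ z ∈ N, p (τ z) := by
  have hne : ∀ z ∈ N, ¬ (s(z, y) : Sym2 V).IsDiag := by
    intro z hz h
    exact hy ((Sym2.mk_isDiag_iff.mp h) ▸ hz)
  have h1 : {ω | ∀ z ∈ N, c s(z, y) ω < τ z} = ⋂ z ∈ N, c s(z, y) ⁻¹' Set.Iio (τ z) := by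
    ext ω
    simp
  rw [h1, H.measureReal_iInter N (fun z => {s(z, y)})]
  · exact prod_congr rfl fun z hz => (H.law _ (hne z hz)).lt _ (hτ z hz)
  · intro z _ z' _ hzz
    simp only [Function.onFun, Set.disjoint_singleton, ne_eq, Sym2.congr_left]
    exact hzz
  · exact fun z hz => measurableSet_linkSigma_preimage c (Set.mem_singleton _) (hne z hz) measurableSet_Iio

/-- The case of no relays is included: the power is then `1` and both sides vanish. -/
lemma IndepLinks.measureReal_exists_ge (H : IndepLinks μ p c) {N : Finset V} {y : V}
    (hy : y ∉ N) {t : ℝ} (ht : 0 ≤ t) :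
    μ.real {ω | ∃ z ∈ N, t ≤ c s(z, y) ω} = 1 - p t ^ #N := by
  have h1 : {ω | ∃ z ∈ N, t ≤ c s(z, y) ω} = {ω | ∀ z ∈ N, c s(z, y) ω < t}ᶜ := by
    ext ω
    simp
  have h2 := (H.linkSigma_le _) _ (measurableSet_exists_ge c (subset_refl N) hy t)
  rw [h1] at h2 ⊢
  rw [probReal_compl_eq_one_sub h2.of_compl, H.measureReal_forall_lt N y hy _ fun _ _ => ht,
    prod_const]

/-- Inclusion–exclusion. The union of the two events has a product complement: since `u ≤ t`, both
fail exactly when the links from `M` are below `u` and those from `N \ M` are below `t`. -/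
lemma IndepLinks.measureReal_exists_ge_and (H : IndepLinks μ p c) {N M : Finset V}
    (hMN : M ⊆ N) {y : V} (hy : y ∉ N) {t u : ℝ} (hu : 0 ≤ u) (hut : u ≤ t) :
    μ.real {ω | (∃ z ∈ M, u ≤ c s(z, y) ω) ∧ ∃ z ∈ N, t ≤ c s(z, y) ω} =
      1 - p u ^ #M - p t ^ #N + p u ^ #M * p t ^ (#N - #M) := by
  classical
  have mM := (H.linkSigma_le _) _ (measurableSet_exists_ge c hMN hy u)
  have mN := (H.linkSigma_le _) _ (measurableSet_exists_ge c (subset_refl N) hy t)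
  have hM := H.measureReal_exists_ge (fun h => hy (hMN h)) (N := M) hu
  have hN := H.measureReal_exists_ge hy (hu.trans hut)
  have hor : μ.real ({ω | ∃ z ∈ M, u ≤ c s(z, y) ω} ∪ {ω | ∃ z ∈ N, t ≤ c s(z, y) ω}) =
      1 - p u ^ #M * p t ^ (#N - #M) := by
    have h1 : {ω | ∃ z ∈ M, u ≤ c s(z, y) ω} ∪ {ω | ∃ z ∈ N, t ≤ c s(z, y) ω} =
        {ω | ∀ z ∈ N, c s(z, y) ω < if z ∈ M then u else t}ᶜ := by
      ext ω
      simp only [Set.mem_union, Set.mem_ofPred_eq, Set.mem_compl_iff, not_forall, not_lt]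
      constructor
      · rintro (⟨z, hz, h⟩ | ⟨z, hz, h⟩)
        · exact ⟨z, hMN hz, by simpa [hz] using h⟩
        · exact ⟨z, hz, le_trans (by split_ifs <;> simp [hut]) h⟩
      · rintro ⟨z, hz, h⟩
        by_cases hzM : z ∈ M
        · exact Or.inl ⟨z, hzM, by simpa [hzM] using h⟩
        · exact Or.inr ⟨z, hz, by simpa [hzM] using h⟩
    have h2 := mM.union mN
    rw [h1] at h2 ⊢
    rw [probReal_compl_eq_one_sub h2.of_compl, H.measureReal_forall_lt N y hy _ (by
      intro z _
      split_ifs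
      · exact hu
      · exact hu.trans hut), ← Finset.prod_sdiff hMN,
      prod_congr rfl (g := fun _ => p t) (fun z hz => by simp [(mem_sdiff.mp hz).2]),
      prod_congr (s₁ := M) rfl (g := fun _ => p u) (fun z hz => by simp [hz]),
      prod_const, prod_const, card_sdiff_of_subset hMN, mul_comm]
  have h3 := measureReal_union_add_inter (μ := μ) (s := {ω | ∃ z ∈ M, u ≤ c s(z, y) ω}) mN
  rw [hor, hM, hN] at h3
  have h4 : {ω | (∃ z ∈ M, u ≤ c s(z, y) ω) ∧ ∃ z ∈ N, t ≤ c s(z, y) ω} =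
    {ω | ∃ z ∈ M, u ≤ c s(z, y) ω} ∩ {ω | ∃ z ∈ N, t ≤ c s(z, y) ω} := rfl
  rw [h4]
  linarith

end Links

/-! ### The outcome of a cycle -/

section Outcome

variable {P : Params} {C : Sym2 (Node P.n) → ℝ}

lemma mem_strong_iff (i : Fin P.n) :
    i ∈ strong P C ↔ P.RD ≤ C s(none, some i) ∧ P.RU ≤ C s(none, some i) := by
  simp [strong, DownDirect, HasUplink]

lemma isRelay_iff (i : Fin P.n) :
    IsRelay P C i ↔ P.RD ≤ C s(none, some i) ∧
      (P.RU ≤ C s(none, some i) ∨ xorRate P C ≤ C s(none, some i)) := by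
  rw [IsRelay, mem_strong_iff]
  simp only [DownDirect, HasUplink, reduceCtorEq, false_or]
  tauto

/-- The sets of nodes that decide the outcome of a cycle, for controller link capacities `x` and
XOR rate `r`: the relays `K`, the relays `L` that reach the controller in the XOR phase, the
clients `NU` whose uplink message depends on other relays, and the clients `ND` whose downlink
message does. -/
structure Roles (P : Params) (r : ℝ) (x : Fin P.n → ℝ) (K L NU ND : Finset (Fin P.n)) :
    Prop where
  relay : ∀ i, i ∈ K ↔ P.RD ≤ x i ∧ (P.RU ≤ x i ∨ r ≤ x i)
  reach : ∀ i, i ∈ L ↔ P.RD ≤ x i ∧ r ≤ x i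
  up : ∀ i, i ∈ NU ↔ x i < P.RU ∧ ¬ (P.RD ≤ x i ∧ r ≤ x i)
  down : ∀ i, i ∈ ND ↔ x i < P.RD ∧ ¬ (P.RU ≤ x i ∧ r ≤ x i)

/-- The messages that depend on relays are delivered. -/
def RelaysSucceed (P : Params) (C : Sym2 (Node P.n) → ℝ) (r : ℝ) (K L NU ND : Finset (Fin P.n)) :
    Prop :=
  (∀ y ∈ NU, ∃ z ∈ L, P.RU ≤ C s(some z, some y)) ∧
    ∀ y ∈ ND, ∃ z ∈ K, max P.RU r ≤ C s(some z, some y)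

/-- A relay `z` serving the downlink of `y` uses their reciprocal link twice, to hear `y` at the
uplink rate and to reach `y` at the XOR rate; hence the maximum. For the uplink it needs this link
only once, but must itself reach the controller. A client in `L` carries its own uplink message, and
a client that has its uplink message at the controller and can hear it at the XOR rate is served by
the controller directly; this is why such clients are removed from `NU` and `ND`. -/
lemma not_cycleFails_iff {K L NU ND : Finset (Fin P.n)}
    (H : Roles P (xorRate P C) (fun i => C s(none, some i)) K L NU ND) :
    ¬ CycleFails P C ↔ RelaysSucceed P C (xorRate P C) K L NU ND := by
  have hup : ∀ y, UplinkDelivered P C y ↔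
      (y ∈ NU → ∃ z ∈ L, P.RU ≤ C s(some z, some y)) := by
    intro y
    have h1 : UplinkDelivered P C y ↔ P.RU ≤ C s(none, some y) ∨
        ∃ z ∈ L, z = y ∨ P.RU ≤ C s(some z, some y) := by
      simp only [UplinkDelivered, HasUplink, XorSender, isRelay_iff, H.reach, reduceCtorEq, false_or,
        Option.some_inj]
      refine or_congr_right' fun hy => exists_congr fun z => ?_
      -- Reciprocity: the relay sends to the controller over the link on which its role was decided.
      rw [Sym2.eq_swap (a := some z) (b := none)]
      constructor
      · rintro ⟨⟨⟨h1, h2⟩, h3⟩, h4⟩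
        exact ⟨⟨h1, h4⟩, h3⟩
      · rintro ⟨⟨h1, h4⟩, h3⟩
        exact ⟨⟨⟨h1, Or.inr h4⟩, h3⟩, h4⟩
    rw [h1, H.up]
    constructor
    · rintro (h | ⟨z, hz, rfl | h⟩) ⟨h3, h4⟩
      · exact absurd h (not_le.mpr h3)
      · exact absurd ((H.reach _).mp hz) h4
      · exact ⟨z, hz, h⟩
    · intro h
      by_cases h3 : P.RU ≤ C s(none, some y)
      · exact Or.inl h3
      · by_cases h4 : y ∈ L
        · exact Or.inr ⟨y, h4, Or.inl rfl⟩
        · obtain ⟨z, hz, h5⟩ := h ⟨not_le.mp h3, fun h6 => h4 ((H.reach y).mpr h6)⟩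
          exact Or.inr ⟨z, hz, Or.inr h5⟩
  have hdown : ∀ y, DownlinkDelivered P C y ↔
      (y ∈ ND → ∃ z ∈ K, max P.RU (xorRate P C) ≤ C s(some z, some y)) := by
    intro y
    have h1 : DownlinkDelivered P C y ↔ P.RD ≤ C s(none, some y) ∨
        (P.RU ≤ C s(none, some y) ∧ xorRate P C ≤ C s(none, some y)) ∨
        ∃ z ∈ K, z ≠ y ∧ max P.RU (xorRate P C) ≤ C s(some z, some y) := by
      simp only [DownlinkDelivered, DownDirect, Option.exists, XorSender, HasUplink, isRelay_iff,
        H.relay, ne_eq, reduceCtorEq, not_false_eq_true, true_and, false_or, Option.some_inj,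
        max_le_iff]
      refine or_congr_right' fun hy => or_congr_right' fun hy' => exists_congr fun z => ?_
      tauto
    rw [h1, H.down]
    constructor
    · rintro (h | h | ⟨z, hz, -, h⟩) ⟨h3, h4⟩
      · exact absurd h (not_le.mpr h3)
      · exact absurd h h4
      · exact ⟨z, hz, h⟩
    · intro h
      by_cases h3 : P.RD ≤ C s(none, some y)
      · exact Or.inl h3
      · by_cases h4 : P.RU ≤ C s(none, some y) ∧ xorRate P C ≤ C s(none, some y)
        · exact Or.inr (Or.inl h4)
        · obtain ⟨z, hz, h5⟩ := h ⟨not_le.mp h3, h4⟩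
          refine Or.inr (Or.inr ⟨z, hz, ?_, h5⟩)
          -- A relay already has the downlink packet, so it cannot be the client that lacks it.
          rintro rfl
          exact h3 ((H.relay z).mp hz).1
  simp only [CycleFails, not_exists, not_not, hup, hdown, RelaysSucceed, forall_and]

end Outcome

/-! ### The probability of an outcome, for prescribed ranges of the controller links -/

/-- Success probability of the relays, given the sizes of the sets in `Roles`, where `u` and `t`
are the link failure probabilities at the uplink rate and at the larger of the two rates. -/
def relaysProb (u t : ℝ) (k l d b w : ℕ) : ℝ :=
  (1 - t ^ k) ^ d * (1 - u ^ l) ^ b * (1 - u ^ l - t ^ k + u ^ l * t ^ (k - l)) ^ w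

section Probability

variable {Ω : Type*} [MeasurableSpace Ω] {μ : Measure Ω} [IsProbabilityMeasure μ] {p : ℝ → ℝ}

/-- Each dependent client `y` owns the links from `K` to `y`. As `NU` and `ND` avoid `K`, no link is
owned twice and independence gives a product. The last three arguments of `relaysProb` count the
clients needing only the downlink, only the uplink, and both. -/
lemma measureReal_relays {n : ℕ} {c : Sym2 (Node n) → Ω → ℝ} (H : IndepLinks μ p c)
    (I : Fin n → Set ℝ) (hI : ∀ i, MeasurableSet (I i)) {K L NU ND : Finset (Fin n)} (hLK : L ⊆ K)
    (hNU : Disjoint NU K) (hND : Disjoint ND K) {u t : ℝ} (hu : 0 ≤ u) (hut : u ≤ t) :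
    μ.real {ω | (∀ i, c s(none, some i) ω ∈ I i) ∧
      (∀ y ∈ NU, ∃ z ∈ L, u ≤ c s(some z, some y) ω) ∧
      ∀ y ∈ ND, ∃ z ∈ K, t ≤ c s(some z, some y) ω} =
    (∏ i, μ.real {ω | c s(none, some i) ω ∈ I i}) *
      relaysProb (p u) (p t) #K #L #(ND \ NU) #(NU \ ND) #(NU ∩ ND) := by
  classical
  set N : Finset (Node n) := K.map Function.Embedding.some with hN
  set M : Finset (Node n) := L.map Function.Embedding.some with hM
  have hMN : M ⊆ N := map_subset_map.mpr hLK
  have hyN : ∀ y ∈ NU ∪ ND, some y ∉ N := by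
    intro y hy h
    have h1 : y ∈ K := by simpa [hN] using h
    rcases mem_union.mp hy with h2 | h2
    · exact disjoint_left.mp hNU h2 h1
    · exact disjoint_left.mp hND h2 h1
  set EU : Fin n → Set Ω := fun y => {ω | ∃ z ∈ M, u ≤ c s(z, some y) ω} with hEU
  set ED : Fin n → Set Ω := fun y => {ω | ∃ z ∈ N, t ≤ c s(z, some y) ω} with hED
  -- Left indices are the controller links, right indices the dependent clients; a requirement that
  -- does not apply to a client is replaced by the whole space.
  set E : Fin n ⊕ Fin n → Set Ω := Sum.elim (fun i => c s(none, some i) ⁻¹' I i)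
    (fun y => (if y ∈ NU then EU y else Set.univ) ∩ (if y ∈ ND then ED y else Set.univ)) with hE
  have hset : {ω | (∀ i, c s(none, some i) ω ∈ I i) ∧
      (∀ y ∈ NU, ∃ z ∈ L, u ≤ c s(some z, some y) ω) ∧
      ∀ y ∈ ND, ∃ z ∈ K, t ≤ c s(some z, some y) ω} =
      ⋂ j ∈ (univ : Finset (Fin n)).disjSum (NU ∪ ND), E j := by
    ext ω
    have h1 : ∀ y, ω ∈ E (Sum.inr y) ↔ (y ∈ NU → ∃ z ∈ L, u ≤ c s(some z, some y) ω) ∧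
        (y ∈ ND → ∃ z ∈ K, t ≤ c s(some z, some y) ω) := by
      intro y
      by_cases h1 : y ∈ NU <;> by_cases h2 : y ∈ ND <;> simp [hE, hEU, hED, hN, hM, h1, h2]
    simp only [Set.mem_iInter, Sum.forall, inl_mem_disjSum, mem_univ, forall_const,
      inr_mem_disjSum, Set.mem_ofPred_eq, h1]
    refine and_congr Iff.rfl ⟨fun h y _ => ⟨h.1 y, h.2 y⟩, fun h => ⟨fun y hy => ?_, fun y hy => ?_⟩⟩
    · exact (h y (mem_union_left _ hy)).1 hy
    · exact (h y (mem_union_right _ hy)).2 hy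
  have hprod : ∏ y ∈ NU ∪ ND, μ.real (E (Sum.inr y)) =
      relaysProb (p u) (p t) #K #L #(ND \ NU) #(NU \ ND) #(NU ∩ ND) := by
    have h1 : NU ∪ ND = (ND \ NU).disjUnion (NU \ ND) disjoint_sdiff_sdiff ∪ NU ∩ ND := by
      ext y
      simp only [mem_union, mem_disjUnion, mem_sdiff, mem_inter]
      tauto
    rw [h1, prod_union, prod_disjUnion, relaysProb]
    · have hcN : #N = #K := card_map _
      have hcM : #M = #L := card_map _
      congr 1
      · congr 1
        · refine prod_eq_pow_card fun y hy => ?_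
          have h2 := mem_sdiff.mp hy
          have h3 : E (Sum.inr y) = ED y := by simp [hE, h2]
          rw [h3, hED, H.measureReal_exists_ge (hyN y (by simp [h2])) (hu.trans hut), hcN]
        · refine prod_eq_pow_card fun y hy => ?_
          have h2 := mem_sdiff.mp hy
          have h3 : E (Sum.inr y) = EU y := by simp [hE, h2]
          rw [h3, hEU, H.measureReal_exists_ge (fun h => hyN y (by simp [h2]) (hMN h)) hu, hcM]
      · refine prod_eq_pow_card fun y hy => ?_
        have h2 := mem_inter.mp hy
        have h3 : E (Sum.inr y) = {ω | (∃ z ∈ M, u ≤ c s(z, some y) ω) ∧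
            ∃ z ∈ N, t ≤ c s(z, some y) ω} := by
          simp [hE, h2, hEU, hED, Set.ofPred_and]
        rw [h3, H.measureReal_exists_ge_and hMN (hyN y (by simp [h2])) hu hut, hcN, hcM]
    · rw [disjoint_left]
      intro y hy
      simp only [mem_disjUnion, mem_sdiff, mem_inter] at hy ⊢
      tauto
  rw [hset, H.measureReal_iInter _
    (Sum.elim (fun i => {s(none, some i)}) fun y => linksTo N (some y)), prod_disjSum, hprod]
  · rfl
  · rintro (i | y) hi (j | z) hj hij
    · simp only [Function.onFun, Sum.elim_inl, Set.disjoint_singleton, ne_eq]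
      intro h
      apply hij
      simpa using h
    · simp only [Function.onFun, Sum.elim_inl, Sum.elim_inr, Set.disjoint_singleton_left]
      rintro ⟨w, hw, h⟩
      obtain ⟨w, -, rfl⟩ := mem_map.mp hw
      simp at h
    · simp only [Function.onFun, Sum.elim_inl, Sum.elim_inr, Set.disjoint_singleton_right]
      rintro ⟨w, hw, h⟩
      obtain ⟨w, -, rfl⟩ := mem_map.mp hw
      simp at h
    · simp only [Function.onFun, Sum.elim_inr, Set.disjoint_left]
      rintro e ⟨w, hw, rfl⟩ ⟨w', hw', h⟩
      have hy : some y ∉ N := hyN y (by simpa using hi)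
      -- A common link with swapped ends would make the dependent client `y` a relay.
      rcases Sym2.eq_iff.mp h with ⟨-, h2⟩ | ⟨h1, h2⟩
      · exact hij (by simpa using h2)
      · exact hy (h2 ▸ hw')
  · rintro (i | y) hj
    · exact measurableSet_linkSigma_preimage c (Set.mem_singleton _) (by simp) (hI i)
    · have hy : some y ∉ N := hyN y (by simpa using hj)
      refine MeasurableSet.inter ?_ ?_
      · split_ifs
        · exact measurableSet_exists_ge c hMN hy u
        · exact MeasurableSet.univ
      · split_ifs
        · exact measurableSet_exists_ge c (subset_refl N) hy t
        · exact MeasurableSet.univ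

end Probability

/-! ### Summation over configurations of the controller links. -/

section Configurations

variable {Ω : Type*} [MeasurableSpace Ω] {μ : Measure Ω} {p : ℝ → ℝ}

lemma measurableSet_relaysSucceed {P : Params} {c : Sym2 (Node P.n) → Ω → ℝ}
    (H : IndepLinks μ p c) {K L NU ND : Finset (Fin P.n)} (hLK : L ⊆ K)
    (hNU : Disjoint NU K) (hND : Disjoint ND K) (r : ℝ) :
    MeasurableSet {ω | RelaysSucceed P (fun e => c e ω) r K L NU ND} := by
  have hmeas : ∀ {y z : Fin P.n}, y ≠ z → Measurable (c s(some z, some y)) := fun {y z} hyz =>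
    (H.law _ (by simpa using hyz.symm)).measurable
  have h1 : ∀ {M N : Finset (Fin P.n)} (t : ℝ), Disjoint M N →
      MeasurableSet {ω | ∀ y ∈ M, ∃ z ∈ N, t ≤ c s(some z, some y) ω} := by
    intro M N t hMN
    have h2 : {ω | ∀ y ∈ M, ∃ z ∈ N, t ≤ c s(some z, some y) ω} =
        ⋂ y ∈ M, ⋃ z ∈ N, {ω | t ≤ c s(some z, some y) ω} := by
      ext ω
      simp
    rw [h2]
    refine Finset.measurableSet_biInter M fun y hy => Finset.measurableSet_biUnion N fun z hz => ?_
    refine measurableSet_le measurable_const (hmeas ?_)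
    rintro rfl
    exact disjoint_left.mp hMN hy hz
  exact (h1 P.RU (hNU.mono_right hLK)).inter (h1 (max P.RU r) hND)

variable [IsProbabilityMeasure μ]

/-- The failure probability of a cycle jointly with prescribed ranges `I i` of the capacities of
the controller links, when these ranges determine the strong clients and the roles. -/
lemma measureReal_config_and_cycleFails {P : Params} {c : Sym2 (Node P.n) → Ω → ℝ}
    (H : IndepLinks μ p c) (hRU : 0 ≤ P.RU) {r : ℝ} {S K L NU ND : Finset (Fin P.n)}
    (hr : P.RX #S = r) (I : Fin P.n → Set ℝ) (hI : ∀ i, MeasurableSet (I i))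
    (hroles : ∀ i, ∀ x ∈ I i, (i ∈ S ↔ P.RD ≤ x ∧ P.RU ≤ x) ∧
      (i ∈ K ↔ P.RD ≤ x ∧ (P.RU ≤ x ∨ r ≤ x)) ∧ (i ∈ L ↔ P.RD ≤ x ∧ r ≤ x) ∧
      (i ∈ NU ↔ x < P.RU ∧ ¬ (P.RD ≤ x ∧ r ≤ x)) ∧
      (i ∈ ND ↔ x < P.RD ∧ ¬ (P.RU ≤ x ∧ r ≤ x))) :
    μ.real {ω | (∀ i, c s(none, some i) ω ∈ I i) ∧ CycleFails P (fun e => c e ω)} =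
      (∏ i, μ.real {ω | c s(none, some i) ω ∈ I i}) *
        (1 - relaysProb (p P.RU) (p (max P.RU r)) #K #L #(ND \ NU) #(NU \ ND) #(NU ∩ ND)) := by
  classical
  -- The inclusion `L ⊆ K` and the disjointness from `K` are read off from one capacity in each
  -- range. If some range is empty, both sides are zero.
  by_cases hne : ∀ i, (I i).Nonempty
  · choose x hx using hne
    have hx' := fun i => hroles i (x i) (hx i)
    have hLK : L ⊆ K := fun i hi =>
      (hx' i).2.1.mpr ⟨((hx' i).2.2.1.mp hi).1, Or.inr ((hx' i).2.2.1.mp hi).2⟩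
    have hNU : Disjoint NU K := disjoint_left.mpr fun i hi hi' => by
      have h1 := (hx' i).2.2.2.1.mp hi
      rcases (hx' i).2.1.mp hi' with ⟨h2, h3 | h3⟩
      · exact absurd h3 (not_le.mpr h1.1)
      · exact h1.2 ⟨h2, h3⟩
    have hND : Disjoint ND K := disjoint_left.mpr fun i hi hi' =>
      absurd ((hx' i).2.1.mp hi').1 (not_le.mpr ((hx' i).2.2.2.2.mp hi).1)
    have hgood := measureReal_relays H I hI hLK hNU hND hRU (le_max_left P.RU r)
    have hall : μ.real {ω | ∀ i, c s(none, some i) ω ∈ I i} =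
        ∏ i, μ.real {ω | c s(none, some i) ω ∈ I i} := by
      -- With no dependent clients, the same lemma gives the probability of the configuration alone.
      have h1 := measureReal_relays (NU := ∅) (ND := ∅) H I hI hLK (disjoint_empty_left _)
        (disjoint_empty_left _) hRU (le_max_left P.RU r)
      simpa [relaysProb] using h1
    have hdiff : {ω | (∀ i, c s(none, some i) ω ∈ I i) ∧ CycleFails P (fun e => c e ω)} =
        {ω | ∀ i, c s(none, some i) ω ∈ I i} \
          {ω | RelaysSucceed P (fun e => c e ω) r K L NU ND} := by
      ext ω
      simp only [Set.mem_ofPred_eq, Set.mem_sdiff]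
      refine and_congr_right fun hω => ?_
      have h1 : strong P (fun e => c e ω) = S := by
        ext i
        rw [mem_strong_iff]
        exact (hroles i _ (hω i)).1.symm
      have h2 : xorRate P (fun e => c e ω) = r := by rw [xorRate, h1, hr]
      have h3 := not_cycleFails_iff (P := P) (C := fun e => c e ω) (K := K) (L := L) (NU := NU)
        (ND := ND) (by
          rw [h2]
          exact ⟨fun i => (hroles i _ (hω i)).2.1, fun i => (hroles i _ (hω i)).2.2.1,
            fun i => (hroles i _ (hω i)).2.2.2.1, fun i => (hroles i _ (hω i)).2.2.2.2⟩)
      rw [h2] at h3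
      rw [← h3, not_not]
    have hadd := measureReal_inter_add_sdiff (μ := μ) (s := {ω | ∀ i, c s(none, some i) ω ∈ I i})
      (measurableSet_relaysSucceed H hLK hNU hND r)
    have hinter : {ω | ∀ i, c s(none, some i) ω ∈ I i} ∩
        {ω | RelaysSucceed P (fun e => c e ω) r K L NU ND} =
        {ω | (∀ i, c s(none, some i) ω ∈ I i) ∧
          (∀ y ∈ NU, ∃ z ∈ L, P.RU ≤ c s(some z, some y) ω) ∧
          ∀ y ∈ ND, ∃ z ∈ K, max P.RU r ≤ c s(some z, some y) ω} := rfl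
    rw [hinter, hgood, hall, ← hdiff] at hadd
    linarith
  · push Not at hne
    obtain ⟨i, hi⟩ := hne
    have h1 : {ω | (∀ i, c s(none, some i) ω ∈ I i) ∧ CycleFails P (fun e => c e ω)} = ∅ := by
      ext ω
      simp only [Set.mem_ofPred_eq, Set.mem_empty_iff_false, iff_false, not_and]
      intro h
      have := h i
      simp [hi] at this
    rw [h1, Finset.prod_eq_zero (mem_univ i) (by simp [hi])]
    simp

open Classical in
/-- The range `J₁`, `J₂`, `J₃` or `J₄` of index `i` when the index set is divided into `A`, `B`,
`D` and the rest. -/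
def cell {ι : Type*} (A B D : Finset ι) (J₁ J₂ J₃ J₄ : Set ℝ) (i : ι) : Set ℝ :=
  if i ∈ A then J₁ else if i ∈ B then J₂ else if i ∈ D then J₃ else J₄

lemma prod_ite_of_pairwise_disjoint {n : ℕ} {A B D : Finset (Fin n)} (hAB : Disjoint A B)
    (hAD : Disjoint A D) (hBD : Disjoint B D) (q₁ q₂ q₃ q₄ : ℝ) :
    (∏ i, if i ∈ A then q₁ else if i ∈ B then q₂ else if i ∈ D then q₃ else q₄) =
      q₁ ^ #A * q₂ ^ #B * q₃ ^ #D * q₄ ^ (n - #A - #B - #D) := by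
  have h1 : univ.filter (fun i => i ∉ A ∧ i ∈ B) = B := by
    ext i
    simpa using fun hi => disjoint_right.mp hAB hi
  have h2 : univ.filter (fun i => (i ∉ A ∧ i ∉ B) ∧ i ∈ D) = D := by
    ext i
    simpa using fun hi => ⟨disjoint_right.mp hAD hi, disjoint_right.mp hBD hi⟩
  have h3 : univ.filter (fun i => (i ∉ A ∧ i ∉ B) ∧ i ∉ D) = (A ∪ B ∪ D)ᶜ := by
    ext i
    simp [and_assoc]
  have h4 : #(A ∪ B ∪ D)ᶜ = n - #A - #B - #D := by
    rw [card_compl, card_union_of_disjoint (disjoint_union_left.mpr ⟨hAD, hBD⟩),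
      card_union_of_disjoint hAB, Fintype.card_fin]
    omega
  simp only [prod_ite, prod_const, filter_filter, h1, h2, h3, h4, filter_mem_eq_inter, univ_inter]
  ring

/-- The form in which all six orderings are treated: at most four ranges of controller capacity
occur. The predicate `Q` records the configuration as the membership equivalences left by repeated
use of `measureReal_eq_sum_powerset`. -/
lemma measureReal_cell_and_cycleFails {P : Params} {c : Sym2 (Node P.n) → Ω → ℝ}
    (H : IndepLinks μ p c) (hRU : 0 ≤ P.RU) {r : ℝ} {S K L NU ND : Finset (Fin P.n)}
    (hr : P.RX #S = r) (A B D : Finset (Fin P.n)) (J₁ J₂ J₃ J₄ : Set ℝ) {q₁ q₂ q₃ q₄ : ℝ}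
    (hAB : Disjoint A B) (hAD : Disjoint A D) (hBD : Disjoint B D)
    (h₁ : MeasurableSet J₁) (h₂ : MeasurableSet J₂) (h₃ : MeasurableSet J₃) (h₄ : MeasurableSet J₄)
    (hq₁ : ∀ i, μ.real {ω | c s(none, some i) ω ∈ J₁} = q₁)
    (hq₂ : ∀ i, μ.real {ω | c s(none, some i) ω ∈ J₂} = q₂)
    (hq₃ : ∀ i, μ.real {ω | c s(none, some i) ω ∈ J₃} = q₃)
    (hq₄ : ∀ i, μ.real {ω | c s(none, some i) ω ∈ J₄} = q₄)
    {Q : Fin P.n → ℝ → Prop} (hQ : ∀ i x, Q i x ↔ x ∈ cell A B D J₁ J₂ J₃ J₄ i)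
    (hroles : ∀ i x, Q i x → (i ∈ S ↔ P.RD ≤ x ∧ P.RU ≤ x) ∧
      (i ∈ K ↔ P.RD ≤ x ∧ (P.RU ≤ x ∨ r ≤ x)) ∧ (i ∈ L ↔ P.RD ≤ x ∧ r ≤ x) ∧
      (i ∈ NU ↔ x < P.RU ∧ ¬ (P.RD ≤ x ∧ r ≤ x)) ∧
      (i ∈ ND ↔ x < P.RD ∧ ¬ (P.RU ≤ x ∧ r ≤ x))) :
    μ.real {ω | CycleFails P (fun e => c e ω) ∧ ∀ i, Q i (c s(none, some i) ω)} =
      q₁ ^ #A * q₂ ^ #B * q₃ ^ #D * q₄ ^ (P.n - #A - #B - #D) *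
        (1 - relaysProb (p P.RU) (p (max P.RU r)) #K #L #(ND \ NU) #(NU \ ND) #(NU ∩ ND)) := by
  have h1 := measureReal_config_and_cycleFails H hRU hr (cell A B D J₁ J₂ J₃ J₄)
    (fun i => by unfold cell; split_ifs <;> assumption)
    (fun i x hx => hroles i x ((hQ i x).mpr hx))
  have h2 : {ω | CycleFails P (fun e => c e ω) ∧ ∀ i, Q i (c s(none, some i) ω)} =
      {ω | (∀ i, c s(none, some i) ω ∈ cell A B D J₁ J₂ J₃ J₄ i) ∧
        CycleFails P (fun e => c e ω)} := by
    ext ω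
    simp only [Set.mem_ofPred_eq, hQ, and_comm]
  rw [h2, h1, ← prod_ite_of_pairwise_disjoint hAB hAD hBD]
  congr 1
  refine prod_congr rfl fun i _ => ?_
  unfold cell
  split_ifs
  · exact hq₁ i
  · exact hq₂ i
  · exact hq₃ i
  · exact hq₄ i

/-- Partition of an event by the set of indices `i` with `x i ∈ J`. -/
lemma measureReal_eq_sum_powerset {ι : Type*} [Finite ι] {x : ι → Ω → ℝ}
    (hx : ∀ i, Measurable (x i)) {J : Set ℝ} (hJ : MeasurableSet J) (E : Ω → Prop) (M : Finset ι)
    (hE : ∀ ω, E ω → ∀ i, x i ω ∈ J → i ∈ M) :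
    μ.real {ω | E ω} = ∑ A ∈ M.powerset, μ.real {ω | E ω ∧ ∀ i, i ∈ A ↔ x i ω ∈ J} := by
  classical
  have := Fintype.ofFinite ι
  have hm : ∀ A : Finset ι, MeasurableSet {ω | ∀ i, i ∈ A ↔ x i ω ∈ J} := by
    intro A
    rw [Set.ofPred_forall]
    refine MeasurableSet.iInter fun i => ?_
    by_cases hi : i ∈ A
    · have h1 : {ω | i ∈ A ↔ x i ω ∈ J} = x i ⁻¹' J := by ext; simp [hi]
      exact h1 ▸ hx i hJ
    · have h1 : {ω | i ∈ A ↔ x i ω ∈ J} = (x i ⁻¹' J)ᶜ := by ext; simp [hi]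
      exact h1 ▸ (hx i hJ).compl
  -- `E` need not be measurable: additivity over the measurable configurations is applied to the
  -- measure restricted to `E`.
  have h1 : ∀ A : Finset ι, μ.real {ω | E ω ∧ ∀ i, i ∈ A ↔ x i ω ∈ J} =
      (μ.restrict {ω | E ω}).real {ω | ∀ i, i ∈ A ↔ x i ω ∈ J} := by
    intro A
    rw [measureReal_restrict_apply (hm A), Set.inter_comm]
    rfl
  simp only [h1]
  rw [← measureReal_biUnion_finset _ fun A _ => hm A, measureReal_restrict_apply]
  · congr 1
    ext ω
    simp only [Set.mem_inter_iff, Set.mem_iUnion, Set.mem_ofPred_eq, mem_powerset, exists_prop]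
    refine ⟨fun h => ⟨⟨univ.filter fun i => x i ω ∈ J, fun i hi => hE ω h i (by simpa using hi),
      fun i => by simp⟩, h⟩, fun h => h.2⟩
  · exact Finset.measurableSet_biUnion _ fun A _ => hm A
  · intro A _ A' _ hne
    refine Set.disjoint_left.mpr fun ω h h' => hne ?_
    ext i
    exact (h i).trans (h' i).symm

/-- Multiplying by the binomial coefficient in the hypothesis, instead of dividing in the
conclusion, lets nested partitions collect exactly the coefficients contained in the factors `B`. -/
lemma sum_powerset_of_choose_mul {ι : Type*} (M : Finset ι) (g : Finset ι → ℝ) (f : ℕ → ℝ)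
    (h : ∀ A ⊆ M, ((#M).choose #A : ℝ) * g A = f #A) :
    ∑ A ∈ M.powerset, g A = ∑ a ∈ Icc 0 #M, f a := by
  have h1 : ∀ A ∈ M.powerset, g A = f #A / ((#M).choose #A : ℝ) := by
    intro A hA
    have h2 := mem_powerset.mp hA
    have h3 : ((#M).choose #A : ℝ) ≠ 0 :=
      Nat.cast_ne_zero.mpr (Nat.choose_pos (card_le_card h2)).ne'
    rw [← h A h2]
    field_simp
  rw [sum_congr rfl h1, sum_powerset_apply_card (fun a => f a / ((#M).choose a : ℝ))]
  have h4 : range (#M + 1) = Icc 0 #M := by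
    ext
    simp
  rw [h4]
  refine sum_congr rfl fun a ha => ?_
  · have h3 : ((#M).choose a : ℝ) ≠ 0 :=
      Nat.cast_ne_zero.mpr (Nat.choose_pos (mem_Icc.mp ha).2).ne'
    rw [nsmul_eq_mul]
    field_simp

end Configurations

/-! ### Algebra of the closed form -/

/-- If `x` is the probability of a range and `q` the conditional failure probability inside it, then
`x * (1 - q)` and `x * q` are the probabilities of its two subranges. This translates the
conditional parameters of the closed form. -/
lemma pow_mul_B {N k : ℕ} (hk : k ≤ N) (x q : ℝ) :
    x ^ N * B N k q = (N.choose k : ℝ) * ((x * (1 - q)) ^ k * (x * q) ^ (N - k)) := by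
  obtain ⟨j, rfl⟩ := Nat.exists_eq_add_of_le hk
  simp only [B, Nat.add_sub_cancel_left, mul_pow, pow_add]
  ring

lemma sum_B_mul_pow (x : ℕ) (u σ : ℝ) :
    ∑ k ∈ Icc 0 x, B x k u * σ ^ k = ((1 - u) * σ + u) ^ x := by
  have h1 : Icc 0 x = range (x + 1) := by
    ext
    simp
  rw [add_pow, h1]
  refine sum_congr rfl fun k _ => ?_
  rw [B, mul_pow]
  ring

/-- Each summand is `B x k u * (1 - σ ^ k * t ^ (s - x))`. By the binomial theorem the sums over `k
≥ 0` of the two parts are `1` and `t ^ s`; removing `k = 0` corrects them by `u ^ x` and `u ^ x * t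
^ (s - x)`. The condition `hσ` says that a link fails at the higher rate if it fails at the lower
one, or passes that and then fails. -/
lemma sum_B_mul_relay {x s : ℕ} (hx : x ≤ s) {u t σ : ℝ} (hσ : (1 - u) * σ + u = t) :
    ∑ k ∈ Icc 1 x, B x k u * (1 - σ ^ k + σ ^ k * (1 - t ^ (s - x))) =
      1 - u ^ x - t ^ s + u ^ x * t ^ (s - x) := by
  have h0 : Icc 0 x = insert 0 (Icc 1 x) := by
    ext
    simp
    omega
  have h1 := sum_B_mul_pow x u 1
  have h2 := sum_B_mul_pow x u σ
  rw [h0, sum_insert (by simp)] at h1 h2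
  have h3 : ∀ k, B x k u * (1 - σ ^ k + σ ^ k * (1 - t ^ (s - x))) =
      B x k u * 1 ^ k - t ^ (s - x) * (B x k u * σ ^ k) := by
    intro k
    ring
  have h4 : t ^ s = t ^ (s - x) * t ^ x := by rw [← pow_add, Nat.sub_add_cancel hx]
  have h5 : B x 0 u = u ^ x := by simp [B]
  simp only [h3, sum_sub_distrib, ← mul_sum]
  rw [h5, hσ] at h2
  rw [h5] at h1
  rw [h4, eq_sub_of_add_eq' h1, eq_sub_of_add_eq' h2]
  ring

namespace LinkLaw

variable {Ω : Type*} [MeasurableSpace Ω] {μ : Measure Ω} {p : ℝ → ℝ} {c : Ω → ℝ} {x y : ℝ}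

lemma mem_Ici [IsProbabilityMeasure μ] (H : LinkLaw μ p c) (hx : 0 ≤ x) : μ.real {ω | c ω ∈ Set.Ici x} = 1 - p x :=
  H.ge hx

lemma mem_Ico [IsProbabilityMeasure μ] (H : LinkLaw μ p c) (hx : 0 ≤ x) (hxy : x ≤ y) :
    μ.real {ω | c ω ∈ Set.Ico x y} = p y - p x :=
  H.ico hx hxy

lemma mem_Iio (H : LinkLaw μ p c) (hx : 0 ≤ x) : μ.real {ω | c ω ∈ Set.Iio x} = p x :=
  H.lt x hx

end LinkLaw

/-! ### The six orderings of the rates. -/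

section Cases

variable {Ω : Type*} [MeasurableSpace Ω] {μ : Measure Ω} [IsProbabilityMeasure μ] {P : Params}
  {c : Sym2 (Node P.n) → Ω → ℝ}

lemma not_isDiag_ctrl {n : ℕ} (i : Fin n) : ¬ (s(none, some i) : Sym2 (Node n)).IsDiag := by simp

/-- Admissible parameters of the network. -/
structure Params.Valid (P : Params) : Prop where
  n : 0 < P.n
  m : 0 < P.m
  W : 0 < P.W
  snr : 0 < P.snr
  TD : 0 < P.TD
  TU : 0 < P.TU
  TX : 0 < P.TX

namespace Params.Valid

lemma RD_pos (hP : P.Valid) : 0 < P.RD := by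
  have := hP.n
  have := hP.m
  have := hP.TD
  unfold Params.RD
  positivity

lemma RU_pos (hP : P.Valid) : 0 < P.RU := by
  have := hP.n
  have := hP.TU
  unfold Params.RU
  positivity

lemma pD_pos (hP : P.Valid) : 0 < P.pD := Params.pfail_pos hP.W hP.snr hP.RD_pos

lemma mul_qUD (hP : P.Valid) : P.pD * P.qUD = P.pU := by
  have := hP.pD_pos.ne'
  unfold Params.qUD
  field_simp

lemma mul_one_sub_qUD (hP : P.Valid) : P.pD * (1 - P.qUD) = P.pD - P.pU := by
  rw [mul_sub, hP.mul_qUD, mul_one]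

end Params.Valid

lemma Params.mul_sUD : (1 - P.pD) * P.sUD = P.pU - P.pD :=
  mul_div_cancel₀ _ (sub_pos.mpr (Params.pfail_lt_one _)).ne'

lemma Params.mul_one_sub_sUD : (1 - P.pD) * (1 - P.sUD) = 1 - P.pU := by
  linear_combination -Params.mul_sUD (P := P)

lemma Params.mul_sXD (s : ℕ) : (1 - P.pD) * P.sXD s = P.pX s - P.pD :=
  mul_div_cancel₀ _ (sub_pos.mpr (Params.pfail_lt_one _)).ne'

lemma Params.mul_sXU (s : ℕ) : (1 - P.pU) * P.sXU s = P.pX s - P.pU :=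
  mul_div_cancel₀ _ (sub_pos.mpr (Params.pfail_lt_one _)).ne'

lemma Params.relaySuccess_eq {x s : ℕ} (hx : x ≤ s) :
    P.relaySuccess s x =
      1 - P.pU ^ x - P.pX s ^ s + P.pU ^ x * P.pX s ^ (s - x) :=
  sum_B_mul_relay hx (by rw [Params.mul_sXU]; ring)

lemma Params.pfail_RD : P.pfail P.RD = P.pD := rfl

lemma Params.pfail_RU : P.pfail P.RU = P.pU := rfl

lemma Params.pfail_RX (s : ℕ) : P.pfail (P.RX s) = P.pX s := rfl

lemma B_apply (n k : ℕ) (p : ℝ) : B n k p = (n.choose k : ℝ) * (1 - p) ^ k * p ^ (n - k) := rfl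

lemma card_compl_fin {n : ℕ} (A : Finset (Fin n)) : #Aᶜ = n - #A := by
  rw [card_compl, Fintype.card_fin]

/-- The strong clients `A` are all the relays, and all reach the controller. Clients in `B` are
heard by the controller and hear it in the XOR phase. The others need both messages, and one link of
capacity at least `P.RU` to `A` provides both. -/
lemma measureReal_cycleFails_of_RX_lt_RU_le_RD (hP : P.Valid) (H : IndepLinks μ P.pfail c) (A : Finset (Fin P.n))
    (h1 : P.RU ≤ P.RD) (h2 : P.RX #A < P.RU) :
    ((P.n).choose #A : ℝ) * μ.real {ω | CycleFails P (fun e => c e ω) ∧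
      ∀ i, i ∈ A ↔ c s(none, some i) ω ∈ Set.Ici P.RD} =
    ∑ b ∈ Icc 0 (P.n - #A), P.fail1 #A b := by
  have hl := fun i : Fin P.n => H.law _ (not_isDiag_ctrl i)
  have hRD := hP.RD_pos.le
  have hRU := hP.RU_pos.le
  rw [measureReal_eq_sum_powerset (fun i => (hl i).measurable) (measurableSet_Ico (a := P.RU)
    (b := P.RD)) _ Aᶜ (fun ω hω i hi => by
      rw [mem_compl, hω.2 i]
      exact fun h => absurd hi.2 (not_lt.mpr h)), mul_sum, ← card_compl_fin A]
  refine sum_powerset_of_choose_mul Aᶜ _ _ fun B hB => ?_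
  have hAB : Disjoint A B := (disjoint_compl_right).mono_right hB
  have hB' : ∀ i ∈ B, i ∉ A := fun i hi => by simpa using hB hi
  simp only [and_assoc, ← forall_and]
  rw [measureReal_cell_and_cycleFails H hRU (S := A) rfl A B ∅ (Set.Ici P.RD)
    (Set.Ico P.RU P.RD) ∅ (Set.Iio P.RU) (K := A) (L := A) (NU := Aᶜ \ B) (ND := Aᶜ \ B)
    (Q := fun i x => (i ∈ A ↔ x ∈ Set.Ici P.RD) ∧ (i ∈ B ↔ x ∈ Set.Ico P.RU P.RD))
    hAB (disjoint_empty_right _) (disjoint_empty_right _) measurableSet_Ici measurableSet_Ico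
    .empty measurableSet_Iio (fun i => (hl i).mem_Ici hRD) (fun i => (hl i).mem_Ico hRU h1)
    (fun i => by simp; rfl) (fun i => (hl i).mem_Iio hRU)]
  · rw [max_eq_left h2.le]
    have hw : #(Aᶜ \ B) = P.n - #A - #B := by rw [card_sdiff_of_subset hB, card_compl_fin]
    have hb : #B ≤ P.n - #A := card_compl_fin A ▸ card_le_card hB
    have hpB := pow_mul_B hb P.pD P.qUD
    rw [hP.mul_qUD, hP.mul_one_sub_qUD] at hpB
    have hF : 1 - relaysProb P.pU P.pU #A #A #((Aᶜ \ B) \ (Aᶜ \ B)) #((Aᶜ \ B) \ (Aᶜ \ B))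
        #((Aᶜ \ B) ∩ (Aᶜ \ B)) = F (P.n - #A - #B) (P.pU ^ #A) := by
      rw [relaysProb, Finset.sdiff_self, inter_self, hw, card_empty, Nat.sub_self, F]
      ring
    simp only [Params.pfail_RD, Params.pfail_RU, hF, Params.fail1, B_apply P.n #A, card_empty, card_compl_fin,
      pow_zero, Nat.sub_zero]
    linear_combination (-(P.n.choose #A : ℝ) * (1 - P.pD) ^ #A *
      F (P.n - #A - #B) (P.pU ^ #A)) * hpB
  · intro i x
    have := hB' i
    unfold cell
    split_ifs <;> simp only [Set.mem_Ici, Set.mem_Ico, Set.mem_Iio] <;> grind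
  · intro i x
    have := hB' i
    simp only [Set.mem_Ici, Set.mem_Ico, mem_sdiff, mem_compl]
    grind

/-- Of the clients `B` heard by the controller, only `B'` hear it in the XOR phase; `B \ B'` need
the downlink from a relay. Clients outside `A ∪ B` need both messages, but their downlink condition
implies the uplink one, so every client outside `A ∪ B'` has the same failure probability. -/
lemma measureReal_cycleFails_of_RU_le_RX_lt_RD (hP : P.Valid) (H : IndepLinks μ P.pfail c) (A : Finset (Fin P.n))
    (h1 : P.RX #A < P.RD) (h2 : P.RU ≤ P.RX #A) :
    ((P.n).choose #A : ℝ) * μ.real {ω | CycleFails P (fun e => c e ω) ∧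
      ∀ i, i ∈ A ↔ c s(none, some i) ω ∈ Set.Ici P.RD} =
    ∑ b ∈ Icc 0 (P.n - #A), ∑ b' ∈ Icc 0 b, P.fail2 #A b b' := by
  have hl := fun i : Fin P.n => H.law _ (not_isDiag_ctrl i)
  have hRD := hP.RD_pos.le
  have hRU := hP.RU_pos.le
  have hRX := hRU.trans h2
  rw [measureReal_eq_sum_powerset (fun i => (hl i).measurable) (measurableSet_Ico (a := P.RU)
    (b := P.RD)) _ Aᶜ (fun ω hω i hi => by
      rw [mem_compl, hω.2 i]
      exact fun h => absurd hi.2 (not_lt.mpr h)), mul_sum, ← card_compl_fin A]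
  refine sum_powerset_of_choose_mul Aᶜ _ (fun b => ∑ b' ∈ Icc 0 b, P.fail2 #A b b') fun B hB => ?_
  rw [measureReal_eq_sum_powerset (fun i => (hl i).measurable) (measurableSet_Ico (a := P.RX #A)
    (b := P.RD)) _ B (fun ω hω i hi => by
      rw [hω.2 i]
      exact ⟨h2.trans hi.1, hi.2⟩), mul_sum, mul_sum]
  refine sum_powerset_of_choose_mul B _ _ fun B' hB' => ?_
  have hAB : Disjoint A B := (disjoint_compl_right).mono_right hB
  have hB1 : ∀ i ∈ B, i ∉ A := fun i hi => by simpa using hB hi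
  simp only [and_assoc, ← forall_and]
  rw [measureReal_cell_and_cycleFails H hRU (S := A) rfl A B' (B \ B') (Set.Ici P.RD)
    (Set.Ico (P.RX #A) P.RD) (Set.Ico P.RU (P.RX #A)) (Set.Iio P.RU) (K := A) (L := A)
    (NU := Aᶜ \ B) (ND := Aᶜ \ B')
    (Q := fun i x => (i ∈ A ↔ x ∈ Set.Ici P.RD) ∧ (i ∈ B ↔ x ∈ Set.Ico P.RU P.RD) ∧
      (i ∈ B' ↔ x ∈ Set.Ico (P.RX #A) P.RD))
    (hAB.mono_right hB') (hAB.mono_right sdiff_subset) disjoint_sdiff measurableSet_Ici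
    measurableSet_Ico measurableSet_Ico measurableSet_Iio (fun i => (hl i).mem_Ici hRD)
    (fun i => (hl i).mem_Ico hRX h1.le) (fun i => (hl i).mem_Ico hRU h2)
    (fun i => (hl i).mem_Iio hRU)]
  · rw [max_eq_right h2]
    have hD : (Aᶜ \ B') \ (Aᶜ \ B) = B \ B' := by
      ext i
      have := hB1 i
      simp only [mem_sdiff, mem_compl]
      tauto
    have hU : (Aᶜ \ B) \ (Aᶜ \ B') = ∅ := by
      ext i
      have := @hB' i
      simp only [mem_sdiff, mem_compl, notMem_empty]
      tauto
    have hUD : (Aᶜ \ B) ∩ (Aᶜ \ B') = Aᶜ \ B := by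
      ext i
      have := @hB' i
      simp only [mem_sdiff, mem_compl, mem_inter]
      tauto
    have hw : #(Aᶜ \ B) = P.n - #A - #B := by rw [card_sdiff_of_subset hB, card_compl_fin]
    have hb : #B ≤ P.n - #A := card_compl_fin A ▸ card_le_card hB
    have hb' : #B' ≤ #B := card_le_card hB'
    have hpB := pow_mul_B hb P.pD P.qUD
    rw [hP.mul_qUD, hP.mul_one_sub_qUD] at hpB
    have hr : (P.pD - P.pU) * P.rUXUD #A = P.pX #A - P.pU :=
      mul_div_cancel₀ _ (sub_pos.mpr (Params.pfail_strictMono hP.W hP.snr (h2.trans_lt h1))).ne'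
    have hr' : (P.pD - P.pU) * (1 - P.rUXUD #A) = P.pD - P.pX #A := by linear_combination -hr
    have hpB' := pow_mul_B hb' (P.pD - P.pU) (P.rUXUD #A)
    rw [hr, hr'] at hpB'
    have he1 : P.n - #A - #B' - (#B - #B') = P.n - #A - #B := by omega
    have he2 : (1 - P.pX #A ^ #A) ^ (P.n - #A - #B') =
        (1 - P.pX #A ^ #A) ^ (#B - #B') * (1 - P.pX #A ^ #A) ^ (P.n - #A - #B) := by
      rw [← pow_add]
      congr 1
      omega
    have hF : 1 - relaysProb P.pU (P.pX #A) #A #A #((Aᶜ \ B') \ (Aᶜ \ B))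
        #((Aᶜ \ B) \ (Aᶜ \ B')) #((Aᶜ \ B) ∩ (Aᶜ \ B')) =
        F (P.n - #A - #B') (P.pX #A ^ #A) := by
      rw [relaysProb, hD, hU, hUD, hw, card_empty, Nat.sub_self, F, he2, card_sdiff_of_subset hB']
      ring
    simp only [Params.pfail_RD, Params.pfail_RU, Params.pfail_RX, hF, Params.fail2,
      B_apply P.n #A, card_compl_fin, card_sdiff_of_subset hB', he1]
    -- The binomial factor in `qUD` is expanded first, with that in `rUXUD` left intact, and the
    -- latter is expanded afterwards.
    linear_combination (-(P.n.choose #A : ℝ) * (1 - P.pD) ^ #A *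
      XorCow.B #B #B' (P.rUXUD #A) * F (P.n - #A - #B') (P.pX #A ^ #A)) * hpB -
      (P.n.choose #A : ℝ) * (1 - P.pD) ^ #A * ((P.n - #A).choose #B : ℝ) *
      P.pU ^ (P.n - #A - #B) * F (P.n - #A - #B') (P.pX #A ^ #A) * hpB'
  · intro i x
    have := hB1 i
    have := @hB' i
    unfold cell
    split_ifs <;> simp only [Set.mem_Ici, Set.mem_Ico, Set.mem_Iio] <;> grind
  · intro i x
    have := hB1 i
    have := @hB' i
    simp only [Set.mem_Ici, Set.mem_Ico, mem_sdiff, mem_compl]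
    grind

/-- All of `A` relays the downlink, but only `X`, with links surviving the XOR rate, can forward an
uplink. No client outside `A` hears the controller in the XOR phase, so `B` needs the downlink and
the rest need both messages. -/
lemma measureReal_cycleFails_of_RU_le_RD_le_RX (hP : P.Valid) (H : IndepLinks μ P.pfail c) (A : Finset (Fin P.n))
    (h1 : P.RD ≤ P.RX #A) (h2 : P.RU ≤ P.RD) :
    ((P.n).choose #A : ℝ) * μ.real {ω | CycleFails P (fun e => c e ω) ∧
      ∀ i, i ∈ A ↔ c s(none, some i) ω ∈ Set.Ici P.RD} =
    ∑ x ∈ Icc 0 #A, ∑ b ∈ Icc 0 (P.n - #A), P.fail6 #A x b := by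
  have hl := fun i : Fin P.n => H.law _ (not_isDiag_ctrl i)
  have hRD := hP.RD_pos.le
  have hRU := hP.RU_pos.le
  have hRX := hRD.trans h1
  rw [measureReal_eq_sum_powerset (fun i => (hl i).measurable) (measurableSet_Ici (a := P.RX #A))
    _ A (fun ω hω i hi => by
      rw [hω.2 i]
      exact h1.trans hi), mul_sum]
  refine sum_powerset_of_choose_mul A _ (fun x => ∑ b ∈ Icc 0 (P.n - #A), P.fail6 #A x b)
    fun X hX => ?_
  rw [measureReal_eq_sum_powerset (fun i => (hl i).measurable) (measurableSet_Ico (a := P.RU)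
    (b := P.RD)) _ Aᶜ (fun ω hω i hi => by
      rw [mem_compl, hω.1.2 i]
      exact fun h => absurd hi.2 (not_lt.mpr h)), mul_sum, mul_sum, ← card_compl_fin A]
  refine sum_powerset_of_choose_mul Aᶜ _ _ fun B hB => ?_
  have hAB : Disjoint A B := (disjoint_compl_right).mono_right hB
  have hB1 : ∀ i ∈ B, i ∉ A := fun i hi => by simpa using hB hi
  simp only [and_assoc, ← forall_and]
  rw [measureReal_cell_and_cycleFails H hRU (S := A) rfl X (A \ X) B (Set.Ici (P.RX #A))
    (Set.Ico P.RD (P.RX #A)) (Set.Ico P.RU P.RD) (Set.Iio P.RU) (K := A) (L := X)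
    (NU := Aᶜ \ B) (ND := Aᶜ)
    (Q := fun i x => (i ∈ A ↔ x ∈ Set.Ici P.RD) ∧ (i ∈ X ↔ x ∈ Set.Ici (P.RX #A)) ∧
      (i ∈ B ↔ x ∈ Set.Ico P.RU P.RD))
    disjoint_sdiff (hAB.mono_left hX) (hAB.mono_left sdiff_subset) measurableSet_Ici
    measurableSet_Ico measurableSet_Ico measurableSet_Iio (fun i => (hl i).mem_Ici hRX)
    (fun i => (hl i).mem_Ico hRD h1) (fun i => (hl i).mem_Ico hRU h2)
    (fun i => (hl i).mem_Iio hRU)]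
  · rw [max_eq_right (h2.trans h1)]
    have hD : Aᶜ \ (Aᶜ \ B) = B := Finset.sdiff_sdiff_eq_self hB
    have hU : (Aᶜ \ B) \ Aᶜ = ∅ := sdiff_eq_empty_iff_subset.mpr sdiff_subset
    have hUD : (Aᶜ \ B) ∩ Aᶜ = Aᶜ \ B := inter_eq_left.mpr sdiff_subset
    have hw : #(Aᶜ \ B) = P.n - #A - #B := by rw [card_sdiff_of_subset hB, card_compl_fin]
    have hb : #B ≤ P.n - #A := card_compl_fin A ▸ card_le_card hB
    have hx : #X ≤ #A := card_le_card hX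
    have ha : #A ≤ P.n := card_finset_fin_le A
    have hpB := pow_mul_B hb P.pD P.qUD
    rw [hP.mul_qUD, hP.mul_one_sub_qUD] at hpB
    have hpX := pow_mul_B hx (1 - P.pD) (P.sXD #A)
    have hr : (1 - P.pD) * (1 - P.sXD #A) = 1 - P.pX #A := by
      linear_combination -Params.mul_sXD (P := P) #A
    rw [Params.mul_sXD, hr] at hpX
    have he1 : P.n - #X - (#A - #X) - #B = P.n - #A - #B := by omega
    have hF : 1 - relaysProb P.pU (P.pX #A) #A #X #(Aᶜ \ (Aᶜ \ B)) #((Aᶜ \ B) \ Aᶜ)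
        #((Aᶜ \ B) ∩ Aᶜ) = 1 - P.success6 #A #X #B := by
      rw [relaysProb, hD, hU, hUD, hw, card_empty, Params.success6, Params.relaySuccess_eq hx]
      ring
    simp only [Params.pfail_RD, Params.pfail_RU, Params.pfail_RX, hF, Params.fail6,
      B_apply P.n #A, card_sdiff_of_subset hX, card_compl_fin, he1]
    linear_combination (-(P.n.choose #A : ℝ) * (1 - P.success6 #A #X #B) * P.pD ^ (P.n - #A) *
      XorCow.B (P.n - #A) #B P.qUD) * hpX - (P.n.choose #A : ℝ) * (1 - P.success6 #A #X #B) *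
      ((#A).choose #X : ℝ) * (1 - P.pX #A) ^ #X * (P.pX #A - P.pD) ^ (#A - #X) * hpB
  · intro i x
    have := hB1 i
    have := @hX i
    unfold cell
    split_ifs <;> simp only [Set.mem_Ici, Set.mem_Ico, Set.mem_Iio] <;> grind
  · intro i x
    have := hB1 i
    have := @hX i
    simp only [Set.mem_Ici, Set.mem_Ico, mem_sdiff, mem_compl]
    grind

/-- Here `A` is not the strong set, so `S` must be fixed before the XOR rate is known. Clients in `A
\ S` failed in the uplink phase but reach the controller in the XOR phase, so all of `A` relays and
`S` affects only the ordering of the rates. -/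
lemma measureReal_cycleFails_of_RX_lt_RD_lt_RU (hP : P.Valid) (H : IndepLinks μ P.pfail c) {A S : Finset (Fin P.n)}
    (hS : S ⊆ A) (h1 : P.RD < P.RU) (h2 : P.RX #S < P.RD) :
    ((#A).choose #S : ℝ) * (((P.n).choose #A : ℝ) * μ.real {ω | (CycleFails P (fun e => c e ω) ∧
      ∀ i, i ∈ A ↔ c s(none, some i) ω ∈ Set.Ici P.RD) ∧
      ∀ i, i ∈ S ↔ c s(none, some i) ω ∈ Set.Ici P.RU}) = P.fail3 #A #S := by
  have hl := fun i : Fin P.n => H.law _ (not_isDiag_ctrl i)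
  have hRD := hP.RD_pos.le
  have hRU := hP.RU_pos.le
  simp only [and_assoc, ← forall_and]
  rw [measureReal_cell_and_cycleFails H hRU (S := S) rfl S (A \ S) ∅ (Set.Ici P.RU)
    (Set.Ico P.RD P.RU) ∅ (Set.Iio P.RD) (K := A) (L := A) (NU := Aᶜ) (ND := Aᶜ)
    (Q := fun i x => (i ∈ A ↔ x ∈ Set.Ici P.RD) ∧ (i ∈ S ↔ x ∈ Set.Ici P.RU))
    disjoint_sdiff (disjoint_empty_right _) (disjoint_empty_right _) measurableSet_Ici
    measurableSet_Ico .empty measurableSet_Iio (fun i => (hl i).mem_Ici hRU)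
    (fun i => (hl i).mem_Ico hRD h1.le) (fun i => by simp; rfl) (fun i => (hl i).mem_Iio hRD)]
  · rw [max_eq_left (h2.trans h1).le]
    have hs : #S ≤ #A := card_le_card hS
    have hpS := pow_mul_B hs (1 - P.pD) P.sUD
    rw [Params.mul_sUD, Params.mul_one_sub_sUD] at hpS
    have hF : 1 - relaysProb P.pU P.pU #A #A #(Aᶜ \ Aᶜ) #(Aᶜ \ Aᶜ) #(Aᶜ ∩ Aᶜ) =
        F (P.n - #A) (P.pU ^ #A) := by
      rw [relaysProb, Finset.sdiff_self, inter_self, card_empty, card_compl_fin, Nat.sub_self, F]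
      ring
    have he1 : P.n - #S - (#A - #S) - 0 = P.n - #A := by omega
    simp only [Params.pfail_RD, Params.pfail_RU, hF, Params.fail3, B_apply P.n #A, card_empty,
      pow_zero, card_sdiff_of_subset hS, he1]
    linear_combination (-(P.n.choose #A : ℝ) * P.pD ^ (P.n - #A) *
      F (P.n - #A) (P.pU ^ #A)) * hpS
  · intro i x
    have := @hS i
    unfold cell
    split_ifs <;> simp only [Set.mem_Ici, Set.mem_Ico, Set.mem_Iio] <;> grind
  · intro i x
    have := @hS i
    simp only [Set.mem_Ici, mem_compl]
    grind

/-- Now only the part `X` of `A \ S` recovers at the XOR rate and joins the relays. The remaining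
clients of `A` need the uplink and those outside `A` need both; as `P.RU` dominates, one adequate
link to `S ∪ X` suffices in either case. -/
lemma measureReal_cycleFails_of_RD_le_RX_lt_RU (hP : P.Valid) (H : IndepLinks μ P.pfail c) {A S : Finset (Fin P.n)}
    (hS : S ⊆ A) (h1 : P.RX #S < P.RU) (h2 : P.RD ≤ P.RX #S) :
    ((#A).choose #S : ℝ) * (((P.n).choose #A : ℝ) * μ.real {ω | (CycleFails P (fun e => c e ω) ∧
      ∀ i, i ∈ A ↔ c s(none, some i) ω ∈ Set.Ici P.RD) ∧
      ∀ i, i ∈ S ↔ c s(none, some i) ω ∈ Set.Ici P.RU}) =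
    ∑ x ∈ Icc 0 (#A - #S), P.fail4 #A #S x := by
  have hl := fun i : Fin P.n => H.law _ (not_isDiag_ctrl i)
  have hRD := hP.RD_pos.le
  have hRU := hP.RU_pos.le
  have hRX := hRD.trans h2
  rw [measureReal_eq_sum_powerset (fun i => (hl i).measurable) (measurableSet_Ico (a := P.RX #S)
    (b := P.RU)) _ (A \ S) (fun ω hω i hi => by
      rw [mem_sdiff, hω.1.2 i, hω.2 i]
      exact ⟨h2.trans hi.1, fun h => absurd hi.2 (not_lt.mpr h)⟩), mul_sum, mul_sum,
    ← card_sdiff_of_subset hS]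
  refine sum_powerset_of_choose_mul (A \ S) _ _ fun X hX => ?_
  have hX1 : ∀ i ∈ X, i ∈ A ∧ i ∉ S := fun i hi => by simpa using hX hi
  simp only [and_assoc, ← forall_and]
  have hSX : Disjoint S X := disjoint_sdiff.mono_right hX
  rw [measureReal_cell_and_cycleFails H hRU (S := S) rfl S X ((A \ S) \ X) (Set.Ici P.RU)
    (Set.Ico (P.RX #S) P.RU) (Set.Ico P.RD (P.RX #S)) (Set.Iio P.RD) (K := S ∪ X) (L := S ∪ X)
    (NU := (S ∪ X)ᶜ) (ND := Aᶜ)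
    (Q := fun i x => (i ∈ A ↔ x ∈ Set.Ici P.RD) ∧ (i ∈ S ↔ x ∈ Set.Ici P.RU) ∧
      (i ∈ X ↔ x ∈ Set.Ico (P.RX #S) P.RU))
    hSX (disjoint_sdiff.mono_right sdiff_subset) disjoint_sdiff measurableSet_Ici
    measurableSet_Ico measurableSet_Ico measurableSet_Iio (fun i => (hl i).mem_Ici hRU)
    (fun i => (hl i).mem_Ico hRX h1.le) (fun i => (hl i).mem_Ico hRD h2)
    (fun i => (hl i).mem_Iio hRD)]
  · rw [max_eq_left h1.le]
    have hSXA : S ∪ X ⊆ A := union_subset hS (hX.trans sdiff_subset)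
    have hD : Aᶜ \ (S ∪ X)ᶜ = ∅ := sdiff_eq_empty_iff_subset.mpr (compl_subset_compl.mpr hSXA)
    have hUD : (S ∪ X)ᶜ ∩ Aᶜ = Aᶜ := inter_eq_right.mpr (compl_subset_compl.mpr hSXA)
    have hK : #(S ∪ X) = #S + #X := card_union_of_disjoint hSX
    have hU : #((S ∪ X)ᶜ \ Aᶜ) = #A - (#S + #X) := by
      rw [compl_sdiff_compl, card_sdiff_of_subset hSXA, hK]
    have hs : #S ≤ #A := card_le_card hS
    have ha : #A ≤ P.n := card_finset_fin_le A
    have hsx : #S + #X ≤ #A := hK ▸ card_le_card hSXA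
    have hpS := pow_mul_B hs (1 - P.pD) P.sUD
    rw [Params.mul_sUD, Params.mul_one_sub_sUD] at hpS
    have hr : (P.pU - P.pD) * P.rDXDU #S = P.pX #S - P.pD :=
      mul_div_cancel₀ _ (sub_pos.mpr (Params.pfail_strictMono hP.W hP.snr (h2.trans_lt h1))).ne'
    have hr' : (P.pU - P.pD) * (1 - P.rDXDU #S) = P.pU - P.pX #S := by linear_combination -hr
    have hpX := pow_mul_B (show #X ≤ #A - #S by omega) (P.pU - P.pD) (P.rDXDU #S)
    rw [hr, hr'] at hpX
    have he1 : P.n - #S - #X - (#A - #S - #X) = P.n - #A := by omega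
    have he2 : (1 - P.pU ^ (#S + #X)) ^ (P.n - #S - #X) =
        (1 - P.pU ^ (#S + #X)) ^ (#A - (#S + #X)) * (1 - P.pU ^ (#S + #X)) ^ (P.n - #A) := by
      rw [← pow_add]
      congr 1
      omega
    have hF : 1 - relaysProb P.pU P.pU #(S ∪ X) #(S ∪ X) #(Aᶜ \ (S ∪ X)ᶜ) #((S ∪ X)ᶜ \ Aᶜ)
        #((S ∪ X)ᶜ ∩ Aᶜ) = F (P.n - #S - #X) (P.pU ^ (#S + #X)) := by
      rw [relaysProb, hD, hU, hUD, hK, card_empty, card_compl_fin, Nat.sub_self, F, he2]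
      ring
    simp only [Params.pfail_RD, Params.pfail_RU, Params.pfail_RX, hF, Params.fail4,
      B_apply P.n #A, card_sdiff_of_subset hS, card_sdiff_of_subset hX, he1]
    linear_combination (-(P.n.choose #A : ℝ) * P.pD ^ (P.n - #A) *
      F (P.n - #S - #X) (P.pU ^ (#S + #X)) * XorCow.B (#A - #S) #X (P.rDXDU #S)) * hpS -
      (P.n.choose #A : ℝ) * P.pD ^ (P.n - #A) * F (P.n - #S - #X) (P.pU ^ (#S + #X)) *
      ((#A).choose #S : ℝ) * (1 - P.pU) ^ #S * hpX
  · intro i x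
    have := @hS i
    have := hX1 i
    unfold cell
    split_ifs <;> simp only [Set.mem_Ici, Set.mem_Ico, Set.mem_Iio] <;> grind
  · intro i x
    have := @hS i
    have := hX1 i
    simp only [Set.mem_Ici, Set.mem_Ico, mem_compl, mem_union]
    grind

/-- No client that failed in the uplink phase recovers, so the relays are `S`, of which only `X`
reaches the controller. Clients in `A \ S` need the uplink through `X`; those outside `A` need both
messages. -/
lemma measureReal_cycleFails_of_RD_lt_RU_le_RX (hP : P.Valid) (H : IndepLinks μ P.pfail c) {A S : Finset (Fin P.n)}
    (hS : S ⊆ A) (h1 : P.RU ≤ P.RX #S) (h2 : P.RD < P.RU) :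
    ((#A).choose #S : ℝ) * (((P.n).choose #A : ℝ) * μ.real {ω | (CycleFails P (fun e => c e ω) ∧
      ∀ i, i ∈ A ↔ c s(none, some i) ω ∈ Set.Ici P.RD) ∧
      ∀ i, i ∈ S ↔ c s(none, some i) ω ∈ Set.Ici P.RU}) =
    ∑ x ∈ Icc 0 #S, P.fail5 #A #S x := by
  have hl := fun i : Fin P.n => H.law _ (not_isDiag_ctrl i)
  have hRD := hP.RD_pos.le
  have hRU := hP.RU_pos.le
  have hRX := hRU.trans h1
  rw [measureReal_eq_sum_powerset (fun i => (hl i).measurable) (measurableSet_Ici (a := P.RX #S))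
    _ S (fun ω hω i hi => by
      rw [hω.2 i]
      exact h1.trans hi), mul_sum, mul_sum]
  refine sum_powerset_of_choose_mul S _ _ fun X hX => ?_
  simp only [and_assoc, ← forall_and]
  rw [measureReal_cell_and_cycleFails H hRU (S := S) rfl X (S \ X) (A \ S) (Set.Ici (P.RX #S))
    (Set.Ico P.RU (P.RX #S)) (Set.Ico P.RD P.RU) (Set.Iio P.RD) (K := S) (L := X)
    (NU := Sᶜ) (ND := Aᶜ)
    (Q := fun i x => (i ∈ A ↔ x ∈ Set.Ici P.RD) ∧ (i ∈ S ↔ x ∈ Set.Ici P.RU) ∧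
      (i ∈ X ↔ x ∈ Set.Ici (P.RX #S)))
    disjoint_sdiff (disjoint_sdiff.mono_left hX) (disjoint_sdiff.mono_left sdiff_subset)
    measurableSet_Ici measurableSet_Ico measurableSet_Ico measurableSet_Iio
    (fun i => (hl i).mem_Ici hRX) (fun i => (hl i).mem_Ico hRU h1)
    (fun i => (hl i).mem_Ico hRD h2.le) (fun i => (hl i).mem_Iio hRD)]
  · rw [max_eq_right h1]
    have hD : Aᶜ \ Sᶜ = ∅ := sdiff_eq_empty_iff_subset.mpr (compl_subset_compl.mpr hS)
    have hUD : Sᶜ ∩ Aᶜ = Aᶜ := inter_eq_right.mpr (compl_subset_compl.mpr hS)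
    have hU : #(Sᶜ \ Aᶜ) = #A - #S := by rw [compl_sdiff_compl, card_sdiff_of_subset hS]
    have hs : #S ≤ #A := card_le_card hS
    have hx : #X ≤ #S := card_le_card hX
    have hpS := pow_mul_B hs (1 - P.pD) P.sUD
    rw [Params.mul_sUD, Params.mul_one_sub_sUD] at hpS
    have hpX := pow_mul_B hx (1 - P.pU) (P.sXU #S)
    have hr : (1 - P.pU) * (1 - P.sXU #S) = 1 - P.pX #S := by
      linear_combination -Params.mul_sXU (P := P) #S
    rw [Params.mul_sXU, hr] at hpX
    have he1 : P.n - #X - (#S - #X) - (#A - #S) = P.n - #A := by omega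
    have hF : 1 - relaysProb P.pU (P.pX #S) #S #X #(Aᶜ \ Sᶜ) #(Sᶜ \ Aᶜ) #(Sᶜ ∩ Aᶜ) =
        1 - P.success5 #A #S #X := by
      rw [relaysProb, hD, hU, hUD, card_empty, card_compl_fin, Params.success5,
        Params.relaySuccess_eq hx]
      ring
    simp only [Params.pfail_RD, Params.pfail_RU, Params.pfail_RX, hF, Params.fail5,
      B_apply P.n #A, card_sdiff_of_subset hS, card_sdiff_of_subset hX, he1]
    linear_combination (-(P.n.choose #A : ℝ) * P.pD ^ (P.n - #A) * (1 - P.success5 #A #S #X) *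
      XorCow.B #S #X (P.sXU #S)) * hpS -
      (P.n.choose #A : ℝ) * P.pD ^ (P.n - #A) * (1 - P.success5 #A #S #X) *
      ((#A).choose #S : ℝ) * (P.pU - P.pD) ^ (#A - #S) * hpX
  · intro i x
    have := @hS i
    have := @hX i
    unfold cell
    split_ifs <;> simp only [Set.mem_Ici, Set.mem_Ico, Set.mem_Iio] <;> grind
  · intro i x
    have := @hS i
    have := @hX i
    simp only [Set.mem_Ici, mem_compl]
    grind

/-- The cycle is split by the set `A` of clients decoding the downlink. If `P.RU ≤ P.RD` this is the
strong set and fixes the XOR rate. Otherwise a second split by the strong set `S ⊆ A` is needed,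
which is why the XOR rate varies inside the sum in three of the six terms. In each case exactly one
indicator survives. -/
theorem measureReal_cycleFails (hP : P.Valid) (H : IndepLinks μ P.pfail c) :
    μ.real {ω | CycleFails P (fun e => c e ω)} = P.failFormula := by
  have hl := fun i : Fin P.n => H.law _ (not_isDiag_ctrl i)
  rw [measureReal_eq_sum_powerset (fun i => (hl i).measurable) (measurableSet_Ici (a := P.RD)) _
    univ (fun _ _ i _ => mem_univ i), Params.failFormula]
  have hn : #(univ : Finset (Fin P.n)) = P.n := by simp
  conv_rhs => rw [← hn]
  refine sum_powerset_of_choose_mul univ _ _ fun A _ => ?_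
  rw [hn]
  rcases le_or_gt P.RU P.RD with hUD | hUD
  · have h3 : ¬ P.RD < P.RU := not_lt.mpr hUD
    have h4 : ∀ s, ¬ (P.RX s < P.RU ∧ P.RD ≤ P.RX s) := fun s h =>
      absurd (h.2.trans_lt h.1) (not_lt.mpr hUD)
    rcases lt_or_ge (P.RX #A) P.RU with hX | hX
    · have hRX : P.RX #A < P.RD := hX.trans_le hUD
      rw [measureReal_cycleFails_of_RX_lt_RU_le_RD hP H A hUD hX]
      simp [hUD, hX, h3, h4, hRX.not_ge, hX.not_ge]
    · rcases lt_or_ge (P.RX #A) P.RD with hX' | hX'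
      · rw [measureReal_cycleFails_of_RU_le_RX_lt_RD hP H A hX' hX]
        simp [hX, hX', h3, h4, hX.not_gt, hX'.not_ge]
      · rw [measureReal_cycleFails_of_RU_le_RD_le_RX hP H A hX' hUD]
        simp [hUD, hX', h3, h4, hX.not_gt, hX'.not_gt]
  · have h2 : ¬ (P.RX #A < P.RD ∧ P.RU ≤ P.RX #A) := fun h =>
      absurd (h.2.trans_lt h.1) (not_lt.mpr hUD.le)
    rw [measureReal_eq_sum_powerset (fun i => (hl i).measurable) (measurableSet_Ici (a := P.RU)) _
      A (fun ω hω i hi => by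
        rw [hω.2 i]
        exact hUD.le.trans hi), mul_sum]
    simp only [ge_iff_le, gt_iff_lt, hUD.not_ge, false_and, and_false, if_false, h2, hUD, true_and,
      and_true, sum_const_zero, zero_add, add_zero, ← sum_add_distrib]
    refine sum_powerset_of_choose_mul A _ _ fun S hS => ?_
    rcases lt_or_ge (P.RX #S) P.RD with hX | hX
    · rw [measureReal_cycleFails_of_RX_lt_RD_lt_RU hP H hS hUD hX]
      simp [hX, hX.not_ge, (hX.trans hUD).not_ge]
    · rcases lt_or_ge (P.RX #S) P.RU with hX' | hX'
      · rw [measureReal_cycleFails_of_RD_le_RX_lt_RU hP H hS hX' hX]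
        simp [hX, hX', hX.not_gt, hX'.not_ge]
      · rw [measureReal_cycleFails_of_RD_lt_RU_le_RX hP H hS hX' hUD]
        simp [hX', hX.not_gt, hX'.not_gt]

end Cases

end XorCow

end

/-! ### From fading coefficients to independent links. -/

theorem theorem3 {Ω : Type*} [MeasurableSpace Ω] (μ : Measure Ω) [IsProbabilityMeasure μ]
    (P : XorCow.Params) (hn : 0 < P.n) (hm : 0 < P.m) (hW : 0 < P.W) (hsnr : 0 < P.snr)
    (hTD : 0 < P.TD) (hTU : 0 < P.TU) (hTX : 0 < P.TX)
    -- fading coefficients of the links between distinct nodes: independent and Rayleigh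
    (h : Sym2 (XorCow.Node P.n) → Ω → ℂ)
    (hmeas : ∀ e, ¬ e.IsDiag → Measurable (h e))
    (hindep : iIndepFun (fun e : {e : Sym2 (XorCow.Node P.n) // ¬ e.IsDiag} => h e.1) μ)
    (hlaw : ∀ e, ¬ e.IsDiag →
      HasLaw (fun ω => ‖h e ω‖) (XorCow.rayleighMeasure (1 / 2)) μ) :
    -- single-link failure probability, and the conditional link probabilities
    (∀ e, ¬ e.IsDiag →
      (∀ R : ℝ, 0 ≤ R → μ.real {ω | R > P.capacity (h e ω)} = P.pfail R) ∧
      (P.RU ≤ P.RD →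
        (μ[|{ω | P.capacity (h e ω) < P.RD}]).real {ω | P.capacity (h e ω) < P.RU} = P.qUD) ∧
      (P.RD ≤ P.RU →
        (μ[|{ω | P.capacity (h e ω) > P.RD}]).real {ω | P.capacity (h e ω) < P.RU} = P.sUD) ∧
      (∀ s ≤ P.n,
        (P.RU ≤ P.RX s →
          (μ[|{ω | P.capacity (h e ω) > P.RU}]).real
            {ω | P.capacity (h e ω) < P.RX s} = P.sXU s) ∧
        (P.RD ≤ P.RX s →
          (μ[|{ω | P.capacity (h e ω) > P.RD}]).real
            {ω | P.capacity (h e ω) < P.RX s} = P.sXD s) ∧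
        (P.RU ≤ P.RX s → P.RX s ≤ P.RD → P.RU < P.RD →
          (μ[|{ω | P.RU < P.capacity (h e ω) ∧ P.capacity (h e ω) < P.RD}]).real
            {ω | P.RU < P.capacity (h e ω) ∧ P.capacity (h e ω) < P.RX s} = P.rUXUD s) ∧
        (P.RD ≤ P.RX s → P.RX s ≤ P.RU → P.RD < P.RU →
          (μ[|{ω | P.RD < P.capacity (h e ω) ∧ P.capacity (h e ω) < P.RU}]).real
            {ω | P.RD < P.capacity (h e ω) ∧ P.capacity (h e ω) < P.RX s} = P.rDXDU s))) ∧
    -- probability that the cycle fails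
    μ.real {ω | XorCow.CycleFails P (fun e => P.capacity (h e ω))} = P.failFormula := by
  have hP : P.Valid := ⟨hn, hm, hW, hsnr, hTD, hTU, hTX⟩
  have hlink : ∀ e, ¬ e.IsDiag → XorCow.LinkLaw μ P.pfail (fun ω => P.capacity (h e ω)) :=
    fun e he => ⟨XorCow.Params.measurable_capacity.comp (hmeas e he),
      fun R hR => XorCow.measureReal_capacity_lt hW hsnr (hlaw e he) hR,
      fun R hR => XorCow.measure_capacity_eq hW hsnr (hlaw e he) hR⟩
  have hRD := hP.RD_pos.le
  have hRU := hP.RU_pos.le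
  refine ⟨fun e he => ⟨fun R hR => (hlink e he).lt R hR, fun h1 => (hlink e he).cond_lt_lt hRU h1,
    fun h1 => (hlink e he).cond_gt_lt hRD h1, fun s _ =>
      ⟨fun h1 => (hlink e he).cond_gt_lt hRU h1, fun h1 => (hlink e he).cond_gt_lt hRD h1,
        fun h1 h2 _ => (hlink e he).cond_ioo_ioo hRU h1 h2,
        fun h1 h2 _ => (hlink e he).cond_ioo_ioo hRD h1 h2⟩⟩, ?_⟩
  -- Independence passes from the fading coefficients to the capacities, which are measurable
  -- functions of them.
  exact XorCow.measureReal_cycleFails (c := fun e ω => P.capacity (h e ω)) hP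
    ⟨hindep.comp (fun _ => P.capacity) fun _ => XorCow.Params.measurable_capacity, hlink⟩
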